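/- **Setting.** Let $\mathcal H$ be a complex Hilbert space and $\rho$ a state on $\mathcal H$ (a positive operator of trace one). Let $|\Psi\rangle=\sum_i\sqrt{\lambda_i}\,|\alpha_i\rangle\otimes\langle\alpha_i|\in\mathcal H\otimes\mathcal H^*$ be its canonical purification, for a spectral decomposition $\rho=\sum_i\lambda_i|\alpha_i\rangle\langle\alpha_i|$ with $(\alpha_i)$ orthonormal and $\lambda_i\ge 0$. Let $A_1,\dots,A_n$ be bounded self-adjoint operators on $\mathcal H$, let $N\ge 1$ be an integer, and let $w:S_n\to\mathbb C$ satisfy $\sum_{\sigma\in S_n}w(\sigma)=1$. For $\theta\in\mathbb R^n$ put $$\tilde f^{(N,w)}_{A}(\theta)=\Big[\sum_{\sigma\in S_n}w(\sigma)\,e^{\frac{i\theta_{\sigma(1)}}{N}A_{\sigma(1)}}\cdots e^{\frac{i\theta_{\sigma(n)}}{N}A_{\sigma(n)}}\Big]^N,\qquad C_A(\theta,\rho)=\langle\Psi|\,\tilde f^{(N,w)}_A(\theta)\otimes 1\,|\Psi\rangle .$$ For a compactly supported distribution $u$ and a smooth function $g$, $\int u(x)g(x)\,d^nx$ denotes the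 pairing $\langle u,g\rangle$. **Theorem (Extended Bochner's theorem).** The function $C_A(\cdot,\rho)$ is bounded and smooth, and there is a unique compactly supported distribution $\mathrm{Pr}_A(x,\rho)\in\mathcal E'(\mathbb R^n)\subset\mathcal S'(\mathbb R^n)$ whose Fourier transform is $C_A(\cdot,\rho)$: $$C_A(\theta,\rho)=\int_{\mathbb R^n}\mathrm{Pr}_A(x,\rho)\,e^{i\theta\cdot x}\,d^nx\qquad(\theta\in\mathbb R^n).$$ The identity also holds in the sense of tempered distributions, and $\mathrm{Pr}_A$ is the only tempered distribution for which it does. The support of $\mathrm{Pr}_A$ is contained in $\prod_{j=1}^n S_j$, where $S_j=\{\frac1N(a_1+\dots+a_N): a_1,\dots,a_N\in\mathrm{spec}(A_j)\}$; for $N=1$ this is the product $\prod_j\mathrm{spec}(A_j)$ of the spectra. Moreover: 1. (Normalization) $\int_{\mathbb R^n}\mathrm{Pr}_A(x,\rho)\,d^nx=1$. 2. (Moments) For every multi-index $\alpha\in\mathbb N_0^n$, $$\int_{\mathbb R^n}x^\alpha\,\mathrm{Pr}_A(x,\rho)\,d^nx=\frac{1}{i^{|\alpha|}}\,\frac{\partial^{|\alpha|}}{\partial\theta_1^{\alpha_1}\cdots\partial\theta_n^{\alpha_n}}C_A(\theta,\rho)\Big|_{\theta=0}.$$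 3. (Reality) $\mathrm{Pr}_A$ is real (takes real values on real-valued test functions) if and only if $C_A(-\theta,\rho)=\overline{C_A(\theta,\rho)}$ for all $\theta\in\mathbb R^n$. If $\dim\mathcal H<\infty$, this condition is also equivalent to $\mathrm{Pr}_A$ being a finite signed measure. 4. (Classicality) $\mathrm{Pr}_A$ is a (nonnegative) probability measure if and only if $C_A(\cdot,\rho)$ is a positive definite function, i.e. $\sum_{j,k=1}^m c_j\overline{c_k}\,C_A(t_j-t_k,\rho)\ge 0$ for all $m$, all $t_1,\dots,t_m\in\mathbb R^n$ and all $c_1,\dots,c_m\in\mathbb C$. -/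

import Mathlib

open MeasureTheory Set Filter Topology
open scoped SchwartzMap FourierTransform ContDiff TensorProduct InnerProductSpace ComplexConjugate

noncomputable section

/-! ### The dual Hilbert space, states and canonical purifications -/

section Purification

universe u

variable {H : Type u} [NormedAddCommGroup H] [InnerProductSpace ℂ H] [CompleteSpace H]

variable (H) in
/-- The dual space `H*` of `H`, i.e. the space of bras, with the operator norm. -/
def BraSpace : Type u := StrongDual ℂ H

instance : NormedAddCommGroup (BraSpace H) :=
  inferInstanceAs (NormedAddCommGroup (StrongDual ℂ H))

instance : NormedSpace ℂ (BraSpace H) :=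
  inferInstanceAs (NormedSpace ℂ (StrongDual ℂ H))

/-- The bra `⟨x|`, i.e. the functional `y ↦ ⟨x|y⟩`; every element of `H*` is a bra. -/
def bra : H ≃ₗᵢ⋆[ℂ] BraSpace H := InnerProductSpace.toDual ℂ H

/-- The Hilbert space structure of `H*`: `(⟨ζ|, ⟨η|) = ⟨η|ζ⟩`. -/
instance : InnerProductSpace ℂ (BraSpace H) where
  inner f g := inner ℂ (bra.symm g) (bra.symm f)
  norm_sq_eq_re_inner f := by
    rw [← bra.symm.norm_map f]
    exact norm_sq_eq_re_inner _
  conj_inner_symm f g := inner_conj_symm _ _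
  add_left f g h := by rw [map_add, inner_add_right]
  smul_left f g c := by
    rw [map_smulₛₗ, inner_smul_right]

theorem inner_bra_bra (ζ η : H) : inner ℂ (bra ζ) (bra η) = inner ℂ η ζ := by
  change inner ℂ (bra.symm (bra η)) (bra.symm (bra ζ)) = _
  simp

variable (H) in
/-- The Hilbert space tensor product `H ⊗ H*` (completion of the algebraic tensor product). -/
abbrev HilbertTensorDual : Type u :=
  UniformSpace.Completion (H ⊗[ℂ] BraSpace H)

/-- The elementary tensor `x ⊗ ⟨y|` in `H ⊗ H*`. -/
def ketBra (x y : H) : HilbertTensorDual H :=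
  ((x ⊗ₜ[ℂ] bra y : H ⊗[ℂ] BraSpace H) : HilbertTensorDual H)

/-- The extension `X ⊗ 1` of a bounded operator `X` on `H` to `H ⊗ H*`. -/
def ampliation (X : H →L[ℂ] H) : HilbertTensorDual H →L[ℂ] HilbertTensorDual H :=
  (X.rTensor (BraSpace H)).completion

theorem ampliation_ketBra (X : H →L[ℂ] H) (x y : H) :
    ampliation X (ketBra x y) = ketBra (X x) y := by
  unfold ampliation ketBra
  simp

/-- `ρ` is a state (density operator): positive with unit trace, the trace being computed in any
orthonormal basis. -/
structure IsState (ρ : H →L[ℂ] H) : Prop where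
  isPositive : ρ.IsPositive
  trace_eq_one : ∀ (ι : Type u) (b : HilbertBasis ι ℂ H),
    HasSum (fun i => inner ℂ (b i) (ρ (b i))) 1

/-- `Ψ` is the canonical purification `∑ √λᵢ |αᵢ⟩ ⊗ ⟨αᵢ|` of `ρ` attached to a spectral
decomposition `ρ = ∑ λᵢ |αᵢ⟩⟨αᵢ|`. -/
def IsCanonicalPurification (ρ : H →L[ℂ] H) (Ψ : HilbertTensorDual H) : Prop :=
  ∃ (ι : Type u) (l : ι → ℝ) (α : ι → H), Orthonormal ℂ α ∧ (∀ i, 0 ≤ l i) ∧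
    (∀ x, HasSum (fun i => (l i : ℂ) • inner ℂ (α i) x • α i) (ρ x)) ∧
    HasSum (fun i => (Real.sqrt (l i) : ℂ) • ketBra (α i) (α i)) Ψ

/-! ### The multivariable quantum characteristic function -/

/-- The generalized unitary operator ordering function
`[∑_σ w(σ) e^{i θ_{σ(1)} A_{σ(1)} / N} ⋯ e^{i θ_{σ(n)} A_{σ(n)} / N}]^N`. -/
def unitaryOrdering {n : ℕ} (A : Fin n → H →L[ℂ] H) (N : ℕ) (w : Equiv.Perm (Fin n) → ℂ)
    (θ : EuclideanSpace ℝ (Fin n)) : H →L[ℂ] H :=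
  (∑ σ : Equiv.Perm (Fin n), w σ • (List.ofFn fun j : Fin n =>
    NormedSpace.exp ((Complex.I * (θ (σ j) : ℂ) / (N : ℂ)) • A (σ j))).prod) ^ N

/-- The multivariable quantum characteristic function `⟨Ψ| f̃(θ) ⊗ 1 |Ψ⟩`. -/
def qcf {n : ℕ} (A : Fin n → H →L[ℂ] H) (N : ℕ) (w : Equiv.Perm (Fin n) → ℂ)
    (Ψ : HilbertTensorDual H) (θ : EuclideanSpace ℝ (Fin n)) : ℂ :=
  inner ℂ Ψ (ampliation (unitaryOrdering A N w θ) Ψ)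

end Purification

/-! ### Distributions on `ℝⁿ` -/

section Distributions

variable {n : ℕ}

/-- The linear automorphism `x ↦ x / 2π` of `ℝⁿ`. -/
def scaleEquiv (n : ℕ) : EuclideanSpace ℝ (Fin n) ≃L[ℝ] EuclideanSpace ℝ (Fin n) :=
  ContinuousLinearEquiv.smulLeft (Units.mk0 (2 * Real.pi)⁻¹ (inv_ne_zero Real.two_pi_pos.ne'))

/-- The Fourier transform `φ̂(x) = ∫ e^{i θ·x} φ(θ) dθ` of a Schwartz function, as a Schwartz
function. -/
def charTransform (φ : 𝓢(EuclideanSpace ℝ (Fin n), ℂ)) : 𝓢(EuclideanSpace ℝ (Fin n), ℂ) :=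
  SchwartzMap.compCLMOfContinuousLinearEquiv ℂ (scaleEquiv n) (𝓕⁻ φ)

theorem charTransform_apply (φ : 𝓢(EuclideanSpace ℝ (Fin n), ℂ)) (x : EuclideanSpace ℝ (Fin n)) :
    charTransform φ x = ∫ θ, Complex.exp (Complex.I * (inner ℝ θ x : ℝ)) * φ θ := by
  have h : charTransform φ x = (𝓕⁻ (φ : EuclideanSpace ℝ (Fin n) → ℂ)) ((2 * Real.pi)⁻¹ • x) := by
    rw [← SchwartzMap.fourierInv_coe]
    rfl
  rw [h, Real.fourierInv_eq']
  congr 1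
  ext θ
  rw [inner_smul_right, smul_eq_mul]
  congr 2
  have : (Real.pi : ℂ) ≠ 0 := by exact_mod_cast Real.pi_ne_zero
  push_cast
  field_simp

/-- The function `C` (viewed as the tempered distribution `φ ↦ ∫ C φ`) is the Fourier transform
of the tempered distribution `u`, with the kernel `e^{i θ·x}`: `⟨C, φ⟩ = ⟨u, φ̂⟩`. -/
def IsFourierTransform (u : 𝓢'(EuclideanSpace ℝ (Fin n), ℂ))
    (C : EuclideanSpace ℝ (Fin n) → ℂ) : Prop :=
  ∀ φ : 𝓢(EuclideanSpace ℝ (Fin n), ℂ), ∫ θ, C θ * φ θ = u (charTransform φ)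

/-- `u` belongs to `ℰ'(ℝⁿ)`. -/
def IsCompactlySupported (u : 𝓢'(EuclideanSpace ℝ (Fin n), ℂ)) : Prop :=
  IsCompact (Distribution.dsupport u)

/-- For compactly supported `u` and smooth `g`: the pairing `⟨u, g⟩ = ∫ u(x) g(x) dx` is `c`.
It is the value of `u` at any Schwartz function which agrees with `g` near the support of `u`. -/
def HasIntegral (u : 𝓢'(EuclideanSpace ℝ (Fin n), ℂ)) (g : EuclideanSpace ℝ (Fin n) → ℂ)
    (c : ℂ) : Prop :=
  (∃ ψ : 𝓢(EuclideanSpace ℝ (Fin n), ℂ), ∀ᶠ x in 𝓝ˢ (Distribution.dsupport u), ψ x = g x) ∧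
  ∀ ψ : 𝓢(EuclideanSpace ℝ (Fin n), ℂ),
    (∀ᶠ x in 𝓝ˢ (Distribution.dsupport u), ψ x = g x) → u ψ = c

/-- `u` is real: it takes real values on real-valued test functions. -/
def IsRealDistribution (u : 𝓢'(EuclideanSpace ℝ (Fin n), ℂ)) : Prop :=
  ∀ φ : 𝓢(EuclideanSpace ℝ (Fin n), ℂ), (∀ x, (φ x).im = 0) → (u φ).im = 0

/-- `u` is a (nonnegative) probability measure. -/
def IsProbabilityDistribution (u : 𝓢'(EuclideanSpace ℝ (Fin n), ℂ)) : Prop :=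
  ∃ μ : Measure (EuclideanSpace ℝ (Fin n)), IsProbabilityMeasure μ ∧
    ∀ φ : 𝓢(EuclideanSpace ℝ (Fin n), ℂ), u φ = ∫ x, φ x ∂μ

/-- `u` is a finite signed measure. -/
def IsSignedMeasureDistribution (u : 𝓢'(EuclideanSpace ℝ (Fin n), ℂ)) : Prop :=
  ∃ s : SignedMeasure (EuclideanSpace ℝ (Fin n)), ∀ φ : 𝓢(EuclideanSpace ℝ (Fin n), ℂ),
    u φ = ∫ x, φ x ∂s.toJordanDecomposition.posPart - ∫ x, φ x ∂s.toJordanDecomposition.negPart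

/-- The partial derivative `∂/∂θ_j`. -/
def partialDeriv (j : Fin n) (f : EuclideanSpace ℝ (Fin n) → ℂ) :
    EuclideanSpace ℝ (Fin n) → ℂ :=
  fun θ => lineDeriv ℝ f θ (EuclideanSpace.single j 1)

/-- The mixed partial derivative `∂^{|α|} / ∂θ_1^{α_1} ⋯ ∂θ_n^{α_n}`. -/
def mixedPartialDeriv (α : Fin n → ℕ) (f : EuclideanSpace ℝ (Fin n) → ℂ) :
    EuclideanSpace ℝ (Fin n) → ℂ :=
  (List.finRange n).foldr (fun j g => (partialDeriv j)^[α j] g) f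

/-- `C` is a positive definite function on `ℝⁿ`: all the sums
`∑_{j,k} c_j \bar c_k C(t_j - t_k)` are real and nonnegative. -/
def IsPositiveDefiniteFunction (C : EuclideanSpace ℝ (Fin n) → ℂ) : Prop :=
  ∀ (m : ℕ) (t : Fin m → EuclideanSpace ℝ (Fin n)) (c : Fin m → ℂ),
    0 ≤ (∑ j, ∑ k, c j * conj (c k) * C (t j - t k)).re ∧
    (∑ j, ∑ k, c j * conj (c k) * C (t j - t k)).im = 0

/-- The set `(S + ⋯ + S) / N` of averages of `N` elements of `S`; it is `S` when `N = 1`. -/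
def averages (N : ℕ) (S : Set ℝ) : Set ℝ :=
  {y | ∃ s : Fin N → ℝ, (∀ k, s k ∈ S) ∧ y = (∑ k, s k) / N}

end Distributions

end

/-!
Expanding the product of exponentials shows that `C_A(θ)` is a bounded multilinear form evaluated at
exponentials `exp (i (θ_j / N) A_j)`, one for each slot. Letting every slot act by multiplication
turns it into `C_A(θ) = l (exp (i B(θ)))`, where `B` is a linear family of elements of a commutative
Banach algebra, generating a bounded group, and `l` is a bounded functional. Since the algebra is a
bicommutant, spectra do not grow, so that the joint spectrum of `B` lies in the compact set
`K = ∏ S_j`.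

The Schwartz functional calculus `φ(B) = ∫ f(θ) exp (i B(θ)) dθ`, for `φ = ∫ f(θ) exp (i θ·x) dθ`,
is multiplicative, and by Gelfand theory `φ(B) = 0` as soon as `φ` vanishes near `K`. Hence
`Pr : φ ↦ l(φ(B))` is supported in `K`, and its pairings with exponentials and monomials are the
values of `C_A` and of its derivatives at the origin.

A compactly supported distribution has finite order, so its composition with the Fourier transform
is bounded by a weighted `L²` norm and is given by a density; it is therefore determined by its
pairings with exponentials. In finite dimension `C_A` is a finite sum of exponentials, and `Pr` a
finite sum of point masses. If `C_A` is positive definite then `⟨Pr, |φ|²⟩ ≥ 0`; as a positive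
smooth function is a square near `K`, `Pr` is positive, and Riesz–Markov represents it by a measure.
-/

noncomputable section

section CharTransform

variable {n : ℕ}

/-- `charTransform` as a continuous linear automorphism of the Schwartz space. -/
def charTransformCLE (n : ℕ) :
    𝓢(EuclideanSpace ℝ (Fin n), ℂ) ≃L[ℂ] 𝓢(EuclideanSpace ℝ (Fin n), ℂ) :=
  (FourierTransform.fourierCLE ℂ 𝓢(EuclideanSpace ℝ (Fin n), ℂ)).symm.trans
    (ContinuousLinearEquiv.equivOfInverse
      (SchwartzMap.compCLMOfContinuousLinearEquiv ℂ (scaleEquiv n))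
      (SchwartzMap.compCLMOfContinuousLinearEquiv ℂ (scaleEquiv n).symm)
      (fun f => by ext x; simp) (fun f => by ext x; simp))

theorem charTransformCLE_apply (f : 𝓢(EuclideanSpace ℝ (Fin n), ℂ)) :
    charTransformCLE n f = charTransform f := rfl

theorem charTransform_symm_apply (φ : 𝓢(EuclideanSpace ℝ (Fin n), ℂ)) :
    charTransform ((charTransformCLE n).symm φ) = φ :=
  (charTransformCLE n).apply_symm_apply φ

theorem IsFourierTransform.unique {u v : 𝓢'(EuclideanSpace ℝ (Fin n), ℂ)}
    {C : EuclideanSpace ℝ (Fin n) → ℂ} (hu : IsFourierTransform u C) (hv : IsFourierTransform v C) :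
    u = v := by
  ext φ
  rw [← charTransform_symm_apply φ, ← hu, ← hv]

end CharTransform

section Cutoff

variable {E F : Type*} [NormedAddCommGroup E] [NormedSpace ℝ E] [FiniteDimensional ℝ E]
  [NormedAddCommGroup F] [NormedSpace ℝ F]

theorem exists_contDiff_cutoff {K U : Set E} (hK : IsCompact K) (hU : IsOpen U) (hKU : K ⊆ U) :
    ∃ χ : E → ℝ, ContDiff ℝ ∞ χ ∧ HasCompactSupport χ ∧ tsupport χ ⊆ U ∧ (∀ x, 0 ≤ χ x) ∧
      ∀ᶠ x in 𝓝ˢ K, χ x = 1 := by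
  obtain ⟨L, hL, hKL, hLU⟩ := exists_compact_between hK hU hKU
  obtain ⟨χ, hχ1, hχ0, hχI⟩ := exists_contMDiffMap_one_nhds_of_subset_interior (n := ⊤)
    (modelWithCornersSelf ℝ E) hK.isClosed hKL
  have hχL : tsupport χ ⊆ L :=
    closure_minimal (fun x hx => of_not_not fun h => hx (hχ0 x h)) hL.isClosed
  exact ⟨χ, χ.contMDiff.contDiff, hL.of_isClosed_subset (isClosed_tsupport χ) hχL,
    hχL.trans hLU, fun x => (hχI x).1, hχ1⟩

theorem exists_schwartzMap_eq_near {K U : Set E} (hK : IsCompact K) (hU : IsOpen U) (hKU : K ⊆ U)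
    {g : E → F} (hg : ContDiffOn ℝ ∞ g U) :
    ∃ ψ : 𝓢(E, F), tsupport ψ ⊆ U ∧ ∀ᶠ x in 𝓝ˢ K, ψ x = g x := by
  obtain ⟨χ, hχ, hχc, hχU, -, hχ1⟩ := exists_contDiff_cutoff hK hU hKU
  have hsub : tsupport (fun x => χ x • g x) ⊆ U := (tsupport_smul_subset_left χ g).trans hχU
  have hsmooth : ContDiff ℝ ∞ fun x => χ x • g x := contDiff_iff_contDiffAt.2 fun x => by
    by_cases hx : x ∈ U
    · exact hχ.contDiffAt.smul (hg.contDiffAt (hU.mem_nhds hx))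
    · exact contDiffAt_const.congr_of_eventuallyEq
        (notMem_tsupport_iff_eventuallyEq.1 fun h => hx (hsub h))
  exact ⟨(hχc.smul_right (f' := g)).toSchwartzMap hsmooth, hsub,
    hχ1.mono fun x hx => (congrArg (· • g x) hx).trans (one_smul ℝ (g x))⟩

end Cutoff

section Truncation

variable {E F : Type*} [NormedAddCommGroup E] [NormedSpace ℝ E] [NormedAddCommGroup F]
  [NormedSpace ℝ F] {f : E → ℝ} {G : ℕ → ℝ}

theorem norm_iteratedFDeriv_comp_smul_le (hf : ContDiff ℝ ∞ f)
    (hG : ∀ i x, ‖iteratedFDeriv ℝ i f x‖ ≤ G i) {c : ℝ} (hc0 : 0 ≤ c) (hc1 : c ≤ 1) (i : ℕ)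
    (x : E) : ‖iteratedFDeriv ℝ i (fun x => f (c • x)) x‖ ≤ G i := by
  rw [iteratedFDeriv_comp_const_smul c (hf.of_le (by exact_mod_cast le_top)), norm_smul,
    norm_pow, Real.norm_of_nonneg hc0]
  exact (mul_le_of_le_one_left (norm_nonneg _) (pow_le_one₀ hc0 hc1)).trans (hG i _)

-- Where `f (c • x) ≠ 0` we have `1 ≤ c * ‖x‖`, so one factor `c` is bought with one power of `‖x‖`.
theorem pow_mul_norm_iteratedFDeriv_comp_smul_le (hf : ContDiff ℝ ∞ f)
    (hf0 : ∀ x, ‖x‖ < 1 → f x = 0) (hG : ∀ i x, ‖iteratedFDeriv ℝ i f x‖ ≤ G i) (φ : 𝓢(E, F))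
    {c : ℝ} (hc0 : 0 ≤ c) (hc1 : c ≤ 1) (k l : ℕ) (x : E) :
    ‖x‖ ^ k * ‖iteratedFDeriv ℝ l (fun x => f (c • x) • φ x) x‖ ≤
      c * ∑ i ∈ Finset.range (l + 1), l.choose i * G i *
        SchwartzMap.seminorm ℝ (k + 1) (l - i) φ := by
  have hG0 : ∀ i, 0 ≤ G i := fun i => (norm_nonneg _).trans (hG i 0)
  rcases lt_or_ge (c * ‖x‖) 1 with hx | hx
  · have hzero : (fun x => f (c • x) • φ x) =ᶠ[𝓝 x] fun _ => 0 := by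
      filter_upwards [(continuous_const.mul continuous_norm).continuousAt.eventually
        (gt_mem_nhds hx)] with y hy
      rw [hf0 _ (by rwa [norm_smul, Real.norm_of_nonneg hc0]), zero_smul]
    rw [(hzero.iteratedFDeriv ℝ l).eq_of_nhds]
    simp only [iteratedFDeriv_fun_zero, Pi.zero_apply, norm_zero, mul_zero]
    exact mul_nonneg hc0 (Finset.sum_nonneg fun i _ =>
      mul_nonneg (mul_nonneg (Nat.cast_nonneg _) (hG0 i)) (apply_nonneg _ _))
  · have hleibniz := norm_iteratedFDeriv_smul_le (n := l) (N := ∞)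
      (hf.comp (contDiff_const_smul c)) (φ.smooth ⊤) x (by exact_mod_cast le_top)
    calc ‖x‖ ^ k * ‖iteratedFDeriv ℝ l (fun x => f (c • x) • φ x) x‖
        ≤ ‖x‖ ^ k * ∑ i ∈ Finset.range (l + 1), l.choose i * G i *
            ‖iteratedFDeriv ℝ (l - i) φ x‖ := by
          refine mul_le_mul_of_nonneg_left (hleibniz.trans ?_) (by positivity)
          gcongr with i
          exact norm_iteratedFDeriv_comp_smul_le hf hG hc0 hc1 i x
      _ ≤ (c * ‖x‖) * (‖x‖ ^ k * ∑ i ∈ Finset.range (l + 1), l.choose i * G i *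
            ‖iteratedFDeriv ℝ (l - i) φ x‖) :=
          le_mul_of_one_le_left (mul_nonneg (by positivity) (Finset.sum_nonneg fun i _ =>
            mul_nonneg (mul_nonneg (Nat.cast_nonneg _) (hG0 i)) (norm_nonneg _))) hx
      _ = c * ∑ i ∈ Finset.range (l + 1), l.choose i * G i *
            (‖x‖ ^ (k + 1) * ‖iteratedFDeriv ℝ (l - i) φ x‖) := by
          simp only [Finset.mul_sum]
          exact Finset.sum_congr rfl fun i _ => by ring
      _ ≤ _ := by
          gcongr with i
          · exact mul_nonneg (Nat.cast_nonneg _) (hG0 i)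
          · exact SchwartzMap.le_seminorm ℝ (k + 1) (l - i) φ x

theorem tendsto_smulLeftCLM_comp_smul_zero (hf : f.HasTemperateGrowth)
    (hf0 : ∀ x, ‖x‖ < 1 → f x = 0) (hG : ∀ i x, ‖iteratedFDeriv ℝ i f x‖ ≤ G i) (φ : 𝓢(E, F)) :
    Tendsto (fun c : ℝ => SchwartzMap.smulLeftCLM F (fun x => f (c • x)) φ) (𝓝[>] 0) (𝓝 0) := by
  rw [(schwartz_withSeminorms ℝ E F).tendsto_nhds]
  rintro ⟨k, l⟩ ε hε
  set S : ℝ := ∑ i ∈ Finset.range (l + 1), l.choose i * G i *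
    SchwartzMap.seminorm ℝ (k + 1) (l - i) φ
  have hlim : Tendsto (fun c : ℝ => c * S) (𝓝[>] 0) (𝓝 0) := by
    simpa using (tendsto_nhdsWithin_of_tendsto_nhds (tendsto_id (x := 𝓝 (0 : ℝ)))).mul_const S
  filter_upwards [hlim.eventually (gt_mem_nhds hε), Ioc_mem_nhdsGT one_pos] with c hcS hc
  have hbound := pow_mul_norm_iteratedFDeriv_comp_smul_le hf.1 hf0 hG φ hc.1.le hc.2 k l
  rw [sub_zero]
  refine (SchwartzMap.seminorm_le_bound ℝ k l _
    ((by positivity : (0 : ℝ) ≤ _).trans (hbound 0)) fun x => ?_).trans_lt hcS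
  have hfc : (fun x => f (c • x)).HasTemperateGrowth :=
    hf.comp (c • ContinuousLinearMap.id ℝ E).hasTemperateGrowth
  rw [SchwartzMap.smulLeftCLM_apply hfc]
  exact hbound x

theorem exists_norm_iteratedFDeriv_one_sub_le {χ : E → ℝ} (hχ : ContDiff ℝ ∞ χ)
    (hχc : HasCompactSupport χ) (i : ℕ) :
    ∃ C : ℝ, ∀ x, ‖iteratedFDeriv ℝ i (fun x => 1 - χ x) x‖ ≤ C := by
  obtain ⟨C, hC⟩ := (hχc.iteratedFDeriv (𝕜 := ℝ) i).exists_bound_of_continuous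
    (hχ.continuous_iteratedFDeriv (m := i) (by exact_mod_cast le_top))
  refine ⟨1 + C, fun x => ?_⟩
  rw [show (fun x => 1 - χ x) = (fun _ => 1) - χ from rfl, iteratedFDeriv_sub_apply
    contDiffAt_const (hχ.contDiffAt.of_le (by exact_mod_cast le_top))]
  refine (norm_sub_le _ _).trans (add_le_add ?_ (hC x))
  rcases eq_or_ne i 0 with rfl | hi
  · simp
  · simp [iteratedFDeriv_const_of_ne hi]

end Truncation

section Support

variable {E F : Type*} [NormedAddCommGroup E] [NormedSpace ℝ E] [FiniteDimensional ℝ E]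
  [NormedAddCommGroup F] [NormedSpace ℂ F] (u : 𝓢'(E, F))

theorem apply_eq_zero_of_hasCompactSupport (φ : 𝓢(E, ℂ)) (hφ : HasCompactSupport φ)
    (h : tsupport φ ⊆ (Distribution.dsupport u)ᶜ) : u φ = 0 := by
  rw [Distribution.compl_dsupport_eq_sUnion_isBounded, sUnion_eq_iUnion] at h
  obtain ⟨η, hη⟩ := SmoothPartitionOfUnity.exists_isSubordinate (modelWithCornersSelf ℝ E)
    (isClosed_tsupport φ) _ (fun V => V.2.2.1) h
  have hfin := η.locallyFinite.finite_nonempty_inter_compact hφ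
  have hgrowth : ∀ V, Function.HasTemperateGrowth (η V) := fun V =>
    HasCompactSupport.hasTemperateGrowth
      (Metric.isCompact_of_isClosed_isBounded (isClosed_tsupport _) (V.2.2.2.subset (hη V)))
      (η V).contMDiff.contDiff
  have hsum : φ = ∑ V ∈ hfin.toFinset, SchwartzMap.smulLeftCLM ℂ (η V) φ := by
    ext x
    simp only [sum_apply, SchwartzMap.smulLeftCLM_apply_apply (hgrowth _), ← Finset.sum_smul]
    by_cases hx : φ x = 0
    · rw [hx, smul_zero]
    have hxφ := subset_tsupport φ hx
    rw [← finsum_eq_sum_of_support_subset, η.sum_eq_one hxφ, one_smul]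
    exact fun V hV => hfin.mem_toFinset.2 ⟨x, hV, hxφ⟩
  rw [hsum, map_sum]
  exact Finset.sum_eq_zero fun V _ => V.2.1 _
    (((SchwartzMap.tsupport_smulLeftCLM_subset _ _).trans inter_subset_right).trans (hη V))

theorem apply_eq_zero_of_eventually_eq_zero (φ : 𝓢(E, ℂ))
    (h : ∀ᶠ x in 𝓝ˢ (Distribution.dsupport u), φ x = 0) : u φ = 0 := by
  obtain ⟨χ, hχ, hχc, -, -, hχ1⟩ := exists_contDiff_cutoff
    (isCompact_closedBall (0 : E) 1) isOpen_univ (subset_univ _)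
  have hχg := hχc.hasTemperateGrowth hχ
  have h1χ : (fun x => 1 - χ x).HasTemperateGrowth := by fun_prop
  choose G hG using exists_norm_iteratedFDeriv_one_sub_le hχ hχc
  have hlim := tendsto_smulLeftCLM_comp_smul_zero h1χ (fun x hx => by
    rw [(eventually_nhdsSet_iff_forall.1 hχ1 x (by simpa using hx.le)).self_of_nhds, sub_self])
    hG φ
  have hulim : Tendsto (u ∘ fun c : ℝ => SchwartzMap.smulLeftCLM ℂ (fun x => 1 - χ (c • x)) φ)
      (𝓝[>] 0) (𝓝 0) :=
    (map_continuous u).tendsto' 0 0 (map_zero u) |>.comp hlim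
  refine tendsto_nhds_unique (tendsto_const_nhds.congr' ?_) hulim
  filter_upwards [self_mem_nhdsWithin] with c (hc : 0 < c)
  have hcg : (fun x => χ (c • x)).HasTemperateGrowth :=
    hχg.comp (c • ContinuousLinearMap.id ℝ E).hasTemperateGrowth
  have hcut : u (SchwartzMap.smulLeftCLM ℂ (fun x => χ (c • x)) φ) = 0 := by
    have hsub := SchwartzMap.tsupport_smulLeftCLM_subset (fun x => χ (c • x)) φ
    refine apply_eq_zero_of_hasCompactSupport u _ ((hχc.comp_smul hc.ne').of_isClosed_subset
      (isClosed_tsupport _) (hsub.trans inter_subset_right))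
      fun x hx hxu => notMem_tsupport_iff_eventuallyEq.2 ?_ (hsub hx).1
    exact eventually_nhdsSet_iff_forall.1 h x hxu
  have hsplit : SchwartzMap.smulLeftCLM ℂ (fun x => 1 - χ (c • x)) φ =
      φ - SchwartzMap.smulLeftCLM ℂ (fun x => χ (c • x)) φ := by
    ext x
    rw [SchwartzMap.smulLeftCLM_apply_apply (by fun_prop), sub_apply,
      SchwartzMap.smulLeftCLM_apply_apply hcg, sub_smul, one_smul]
  rw [Function.comp_apply, hsplit, map_sub, hcut, sub_zero]

theorem apply_congr_of_eventually_eq {φ ψ : 𝓢(E, ℂ)}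
    (h : ∀ᶠ x in 𝓝ˢ (Distribution.dsupport u), φ x = ψ x) : u φ = u ψ := by
  rw [← sub_eq_zero, ← map_sub]
  refine apply_eq_zero_of_eventually_eq_zero u _ (h.mono fun x hx => ?_)
  rw [sub_apply, hx, sub_self]

end Support

section JointExp

variable {E 𝔄 : Type*} [NormedAddCommGroup E] [NormedSpace ℝ E] [NormedCommRing 𝔄]
  [NormedAlgebra ℂ 𝔄]

/-- The group `θ ↦ exp (i B(θ))` generated by a linear family `B` of elements of a commutative
Banach algebra. A tuple `B₁, …, Bₙ` is encoded as the family `θ ↦ ∑ⱼ θⱼ Bⱼ` on `ℝⁿ`. -/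
def jointExp (B : E →L[ℝ] 𝔄) (θ : E) : 𝔄 :=
  NormedSpace.exp (Complex.I • B θ)

theorem jointExp_zero (B : E →L[ℝ] 𝔄) : jointExp B 0 = 1 := by
  rw [jointExp, map_zero, smul_zero, NormedSpace.exp_zero]

/-- The group generated by `B` is bounded; under this assumption the integrals `∫ f(θ) exp (i B(θ))`
converge for every Schwartz function `f`. -/
def GeneratesBoundedGroup (B : E →L[ℝ] 𝔄) : Prop :=
  ∃ M : ℝ, ∀ θ, ‖jointExp B θ‖ ≤ M

theorem GeneratesBoundedGroup.exists_norm_apply_jointExp_le {B : E →L[ℝ] 𝔄}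
    (hB : GeneratesBoundedGroup B) {F : Type*} [NormedAddCommGroup F] [NormedSpace ℂ F]
    (l : 𝔄 →L[ℂ] F) : ∃ M : ℝ, ∀ θ, ‖l (jointExp B θ)‖ ≤ M := by
  obtain ⟨M, hM⟩ := hB
  exact ⟨‖l‖ * M, fun θ => l.le_opNorm_of_le (hM θ)⟩

variable [CompleteSpace 𝔄]

theorem jointExp_add (B : E →L[ℝ] 𝔄) (s t : E) :
    jointExp B (s + t) = jointExp B s * jointExp B t := by
  let _ := NormedAlgebra.restrictScalars ℚ ℂ 𝔄
  rw [jointExp, map_add, smul_add, NormedSpace.exp_add, jointExp, jointExp]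

theorem contDiff_jointExp (B : E →L[ℝ] 𝔄) : ContDiff ℝ ∞ (jointExp B) := by
  have hexp : AnalyticOnNhd ℝ (NormedSpace.exp : 𝔄 → 𝔄) univ := fun x _ =>
    (NormedSpace.exp_analytic (𝕂 := ℂ) x).restrictScalars
  exact (contDiffOn_univ.1 (hexp.contDiffOn uniqueDiffOn_univ)).comp
    (B.contDiff.const_smul Complex.I)

theorem hasFDerivAt_jointExp (B : E →L[ℝ] 𝔄) (θ : E) :
    HasFDerivAt (jointExp B) (jointExp B θ • Complex.I • B) θ := by
  have hexp := hasStrictFDerivAt_exp (𝕂 := ℝ) (x := Complex.I • B θ)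
  exact hexp.hasFDerivAt.comp θ (B.hasFDerivAt.const_smul Complex.I)

theorem character_jointExp (χ : WeakDual.characterSpace ℂ 𝔄) (B : E →L[ℝ] 𝔄) (θ : E) :
    χ (jointExp B θ) = Complex.exp (Complex.I * χ (B θ)) := by
  let _ := NormedAlgebra.restrictScalars ℚ ℂ 𝔄
  rw [jointExp, NormedSpace.map_exp χ (map_continuous χ), map_smul, smul_eq_mul,
    Complex.exp_eq_exp_ℂ]

end JointExp

section Point

variable {E : Type*} [NormedAddCommGroup E] [InnerProductSpace ℝ E]

/-- The family `θ ↦ ⟨θ, x⟩` of scalars attached to a point `x`, so that the group it generates is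
the character `θ ↦ e^{i θ·x}`. -/
def pointFamily (x : E) : E →L[ℝ] ℂ :=
  Complex.ofRealCLM ∘L innerSL ℝ x

theorem pointFamily_apply (x θ : E) : pointFamily x θ = (inner ℝ θ x : ℝ) := by
  simp [pointFamily, real_inner_comm]

theorem jointExp_pointFamily (x θ : E) :
    jointExp (pointFamily x) θ = Complex.exp (Complex.I * (inner ℝ θ x : ℝ)) := by
  rw [jointExp, pointFamily_apply, Complex.exp_eq_exp_ℂ, smul_eq_mul]

theorem generatesBoundedGroup_pointFamily (x : E) : GeneratesBoundedGroup (pointFamily x) :=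
  ⟨1, fun θ => by rw [jointExp_pointFamily, mul_comm, Complex.norm_exp_ofReal_mul_I]⟩

end Point

section Smear

variable {E 𝔄 : Type*} [NormedAddCommGroup E] [InnerProductSpace ℝ E] [FiniteDimensional ℝ E]
  [MeasurableSpace E] [BorelSpace E] [NormedCommRing 𝔄] [NormedAlgebra ℂ 𝔄] {B : E →L[ℝ] 𝔄}

namespace GeneratesBoundedGroup

theorem norm_integral_smul_le {M : ℝ} (hM : ∀ θ, ‖jointExp B θ‖ ≤ M) (f : 𝓢(E, ℂ)) :
    ‖∫ θ, f θ • jointExp B θ‖ ≤ M * ‖f.toLp 1‖ := by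
  rw [SchwartzMap.norm_toLp_one, ← integral_const_mul]
  refine norm_integral_le_of_norm_le (f.integrable.norm.const_mul M)
    (Eventually.of_forall fun θ => ?_)
  rw [norm_smul, mul_comm]
  exact mul_le_mul_of_nonneg_right (hM θ) (norm_nonneg _)

variable [CompleteSpace 𝔄]

theorem integrable_smul (hB : GeneratesBoundedGroup B) (f : 𝓢(E, ℂ)) :
    Integrable fun θ => f θ • jointExp B θ :=
  f.integrable.smul_bdd hB.choose (contDiff_jointExp B).continuous.aestronglyMeasurable
    (Eventually.of_forall hB.choose_spec)

/-- The integral `∫ f(θ) exp (i B(θ)) dθ` of a bounded group against a Schwartz function. -/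
def smear (hB : GeneratesBoundedGroup B) : 𝓢(E, ℂ) →L[ℂ] 𝔄 :=
  SchwartzMap.mkCLMtoNormedSpace (fun f => ∫ θ, f θ • jointExp B θ)
    (fun f g => by
      simp only [add_apply, add_smul]
      exact integral_add (hB.integrable_smul f) (hB.integrable_smul g))
    (fun c f => by
      simp only [smul_apply, smul_assoc]
      exact integral_smul c _)
    (by
      obtain ⟨M, hM⟩ := hB
      obtain ⟨k, C, hC, hCf⟩ := SchwartzMap.norm_toLp_le_seminorm ℂ ℂ 1 (volume : Measure E)
      have hM0 : 0 ≤ M := (norm_nonneg _).trans (hM 0)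
      refine ⟨Finset.Iic (k, 0), M * C, mul_nonneg hM0 hC, fun f => ?_⟩
      rw [mul_assoc]
      exact (norm_integral_smul_le hM f).trans (mul_le_mul_of_nonneg_left (hCf f) hM0))

theorem smear_apply (hB : GeneratesBoundedGroup B) (f : 𝓢(E, ℂ)) :
    hB.smear f = ∫ θ, f θ • jointExp B θ := rfl

theorem apply_smear {𝔅 : Type*} [NormedAddCommGroup 𝔅] [NormedSpace ℂ 𝔅] [CompleteSpace 𝔅]
    (hB : GeneratesBoundedGroup B) (l : 𝔄 →L[ℂ] 𝔅) (f : 𝓢(E, ℂ)) :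
    l (hB.smear f) = ∫ θ, f θ • l (jointExp B θ) := by
  rw [smear_apply, ← l.integral_comp_comm (hB.integrable_smul f)]
  simp only [map_smul]

theorem smear_lineDerivOp (hB : GeneratesBoundedGroup B) (f : 𝓢(E, ℂ)) (v : E) :
    hB.smear (LineDeriv.lineDerivOp v f) = -(Complex.I • B v * hB.smear f) := by
  have hderiv : ∀ θ, HasLineDerivAt ℝ (jointExp B) (Complex.I • B v * jointExp B θ) θ v :=
    fun θ => by
      simpa only [smul_apply, smul_eq_mul, mul_comm] using
        (hasFDerivAt_jointExp B θ).hasLineDerivAt v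
  have hint : Integrable fun θ => f θ • (Complex.I • B v * jointExp B θ) := by
    simpa only [mul_smul_comm] using (hB.integrable_smul f).const_mul (Complex.I • B v)
  have hparts := integral_bilinear_hasLineDerivAt_right_eq_neg_left_of_integrable (μ := volume)
    (B := (ContinuousLinearMap.lsmul ℝ ℂ : ℂ →L[ℝ] 𝔄 →L[ℝ] 𝔄))
    (f' := LineDeriv.lineDerivOp v f) (hB.integrable_smul _) hint (hB.integrable_smul f)
    (fun θ _ => by
      rw [SchwartzMap.lineDerivOp_apply_eq_fderiv]
      exact (f.hasFDerivAt θ).hasLineDerivAt v)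
    (fun θ _ => hderiv θ)
  simp only [ContinuousLinearMap.lsmul_apply] at hparts
  rw [smear_apply, ← neg_eq_iff_eq_neg.2 hparts, smear_apply,
    ← integral_const_mul_of_integrable (hB.integrable_smul f)]
  simp only [mul_smul_comm]

theorem smear_compSubConstCLM (hB : GeneratesBoundedGroup B) (f : 𝓢(E, ℂ)) (τ : E) :
    hB.smear (SchwartzMap.compSubConstCLM ℂ τ f) = jointExp B τ * hB.smear f := by
  rw [smear_apply, ← integral_add_right_eq_self _ τ, smear_apply,
    ← integral_const_mul_of_integrable (hB.integrable_smul f)]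
  simp only [SchwartzMap.compSubConstCLM_apply, add_sub_cancel_right, jointExp_add, mul_smul_comm,
    mul_comm]

theorem smear_convolution (hB : GeneratesBoundedGroup B) (f g : 𝓢(E, ℂ)) :
    hB.smear (SchwartzMap.convolution (ContinuousLinearMap.mul ℂ ℂ) f g) =
      hB.smear f * hB.smear g := by
  have hint : Integrable (fun p : E × E => (f p.2 * g (p.1 - p.2)) • jointExp B p.1)
      (volume.prod volume) :=
    (f.integrable.convolution_integrand (ContinuousLinearMap.mul ℂ ℂ) g.integrable).smul_bdd
      hB.choose ((contDiff_jointExp B).continuous.comp continuous_fst).aestronglyMeasurable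
      (Eventually.of_forall fun p => hB.choose_spec p.1)
  have hinner : ∀ s, ∫ v, (f s * g (v - s)) • jointExp B v =
      (f s • jointExp B s) * hB.smear g := fun s => by
    rw [smul_mul_assoc, ← hB.smear_compSubConstCLM, smear_apply, ← integral_smul]
    simp only [SchwartzMap.compSubConstCLM_apply, smul_smul]
  calc hB.smear (SchwartzMap.convolution (ContinuousLinearMap.mul ℂ ℂ) f g)
      = ∫ v, ∫ s, (f s * g (v - s)) • jointExp B v := by
        rw [smear_apply]
        refine integral_congr_ae (Eventually.of_forall fun v => ?_)
        dsimp only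
        rw [SchwartzMap.convolution_apply, convolution_def, ← integral_smul_const]
        rfl
    _ = ∫ s, ∫ v, (f s * g (v - s)) • jointExp B v := integral_integral_swap hint
    _ = ∫ s, (f s • jointExp B s) * hB.smear g := by simp only [hinner]
    _ = hB.smear f * hB.smear g := integral_mul_const_of_integrable (hB.integrable_smul f)

theorem smear_pointFamily {n : ℕ} (x : EuclideanSpace ℝ (Fin n))
    (f : 𝓢(EuclideanSpace ℝ (Fin n), ℂ)) :
    (generatesBoundedGroup_pointFamily x).smear f = charTransform f x := by
  simp only [charTransform_apply, smear_apply, jointExp_pointFamily, smul_eq_mul, mul_comm]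

end GeneratesBoundedGroup

end Smear

section CharTransformRules

variable {n : ℕ}

theorem charTransform_convolution (f g : 𝓢(EuclideanSpace ℝ (Fin n), ℂ)) :
    charTransform (SchwartzMap.convolution (ContinuousLinearMap.mul ℂ ℂ) f g) =
      SchwartzMap.smulLeftCLM ℂ (charTransform f) (charTransform g) := by
  ext x
  rw [SchwartzMap.smulLeftCLM_apply_apply (charTransform f).hasTemperateGrowth, smul_eq_mul]
  simp only [← GeneratesBoundedGroup.smear_pointFamily]
  exact GeneratesBoundedGroup.smear_convolution _ f g

theorem charTransform_compSubConstCLM (f : 𝓢(EuclideanSpace ℝ (Fin n), ℂ))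
    (τ x : EuclideanSpace ℝ (Fin n)) :
    charTransform (SchwartzMap.compSubConstCLM ℂ τ f) x =
      Complex.exp (Complex.I * (inner ℝ τ x : ℝ)) * charTransform f x := by
  simp only [← GeneratesBoundedGroup.smear_pointFamily,
    GeneratesBoundedGroup.smear_compSubConstCLM, jointExp_pointFamily]

theorem charTransform_lineDerivOp (f : 𝓢(EuclideanSpace ℝ (Fin n), ℂ))
    (v x : EuclideanSpace ℝ (Fin n)) :
    charTransform (LineDeriv.lineDerivOp v f) x =
      -(Complex.I * (inner ℝ v x : ℝ) * charTransform f x) := by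
  simp only [← GeneratesBoundedGroup.smear_pointFamily, GeneratesBoundedGroup.smear_lineDerivOp,
    pointFamily_apply, smul_eq_mul]

end CharTransformRules

section JointCalculus

variable {𝔄 : Type*} [NormedCommRing 𝔄] [NormedAlgebra ℂ 𝔄] [CompleteSpace 𝔄] {n : ℕ}
  {B : EuclideanSpace ℝ (Fin n) →L[ℝ] 𝔄} {K : Set (EuclideanSpace ℝ (Fin n))}

namespace GeneratesBoundedGroup

/-- The Schwartz functional calculus `φ ↦ φ(B)` of a family generating a bounded group, defined by
Fourier inversion: `φ̂(B) = ∫ φ(θ) exp (i B(θ)) dθ`. -/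
def calculus (hB : GeneratesBoundedGroup B) : 𝓢(EuclideanSpace ℝ (Fin n), ℂ) →L[ℂ] 𝔄 :=
  hB.smear ∘L (charTransformCLE n).symm

theorem calculus_charTransform (hB : GeneratesBoundedGroup B)
    (f : 𝓢(EuclideanSpace ℝ (Fin n), ℂ)) : hB.calculus (charTransform f) = hB.smear f :=
  congrArg hB.smear ((charTransformCLE n).symm_apply_apply f)

theorem calculus_smulLeftCLM (hB : GeneratesBoundedGroup B)
    (φ ψ : 𝓢(EuclideanSpace ℝ (Fin n), ℂ)) :
    hB.calculus (SchwartzMap.smulLeftCLM ℂ φ ψ) = hB.calculus φ * hB.calculus ψ := by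
  obtain ⟨f, rfl⟩ := (charTransformCLE n).surjective φ
  obtain ⟨g, rfl⟩ := (charTransformCLE n).surjective ψ
  simp only [charTransformCLE_apply]
  rw [← charTransform_convolution]
  simp only [calculus_charTransform, smear_convolution]

theorem calculus_exp_mul (hB : GeneratesBoundedGroup B) (τ : EuclideanSpace ℝ (Fin n))
    {φ ψ : 𝓢(EuclideanSpace ℝ (Fin n), ℂ)}
    (h : ∀ x, ψ x = Complex.exp (Complex.I * (inner ℝ τ x : ℝ)) * φ x) :
    hB.calculus ψ = jointExp B τ * hB.calculus φ := by
  obtain ⟨f, rfl⟩ := (charTransformCLE n).surjective φ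
  rw [charTransformCLE_apply, calculus_charTransform, ← smear_compSubConstCLM,
    ← calculus_charTransform]
  congr 1
  ext x
  rw [h, charTransform_compSubConstCLM, charTransformCLE_apply]

theorem calculus_inner_mul (hB : GeneratesBoundedGroup B) (v : EuclideanSpace ℝ (Fin n))
    {φ ψ : 𝓢(EuclideanSpace ℝ (Fin n), ℂ)} (h : ∀ x, ψ x = (inner ℝ v x : ℝ) * φ x) :
    hB.calculus ψ = B v * hB.calculus φ := by
  obtain ⟨f, rfl⟩ := (charTransformCLE n).surjective φ
  have hψ : ψ = charTransform (Complex.I • LineDeriv.lineDerivOp v f) := by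
    ext x
    rw [← charTransformCLE_apply, map_smul, smul_apply, charTransformCLE_apply,
      charTransform_lineDerivOp, h, charTransformCLE_apply, smul_eq_mul]
    linear_combination (inner ℝ v x * charTransform f x) * Complex.I_mul_I
  rw [hψ, charTransformCLE_apply, calculus_charTransform, calculus_charTransform, map_smul,
    smear_lineDerivOp, smul_neg, smul_mul_assoc, smul_smul, Complex.I_mul_I, neg_smul, neg_neg,
    one_smul]

theorem character_calculus (hB : GeneratesBoundedGroup B) {χ : WeakDual.characterSpace ℂ 𝔄}
    {x : EuclideanSpace ℝ (Fin n)} (hx : ∀ θ, χ (B θ) = (inner ℝ θ x : ℝ))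
    (φ : 𝓢(EuclideanSpace ℝ (Fin n), ℂ)) : χ (hB.calculus φ) = φ x := by
  obtain ⟨f, rfl⟩ := (charTransformCLE n).surjective φ
  rw [charTransformCLE_apply, calculus_charTransform, ← smear_pointFamily]
  refine (hB.apply_smear (WeakDual.CharacterSpace.toCLM χ) f).trans ?_
  simp only [WeakDual.CharacterSpace.coe_toCLM, character_jointExp, hx, smear_apply,
    jointExp_pointFamily]

end GeneratesBoundedGroup

/-- The family `B` has real joint spectrum contained in `K`: every character `χ` of the algebra is
given on `B` by a point of `K`, which for a tuple `B₁, …, Bₙ` is `(χ(B₁), …, χ(Bₙ))`. -/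
def JointSpectrumSubset (B : EuclideanSpace ℝ (Fin n) →L[ℝ] 𝔄)
    (K : Set (EuclideanSpace ℝ (Fin n))) : Prop :=
  ∀ χ : WeakDual.characterSpace ℂ 𝔄, ∃ x ∈ K, ∀ θ, χ (B θ) = (inner ℝ θ x : ℝ)

namespace GeneratesBoundedGroup

theorem isUnit_calculus (hB : GeneratesBoundedGroup B) (hBK : JointSpectrumSubset B K)
    {φ : 𝓢(EuclideanSpace ℝ (Fin n), ℂ)} (h : ∀ x ∈ K, φ x ≠ 0) : IsUnit (hB.calculus φ) := by
  by_contra hn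
  obtain ⟨χ, hχ⟩ := WeakDual.CharacterSpace.exists_apply_eq_zero hn
  obtain ⟨x, hxK, hx⟩ := hBK χ
  exact h x hxK ((hB.character_calculus hx φ).symm.trans hχ)

-- With `χ = 1` near `K` the element `χ(B)` is invertible, so `χ φ = c χ` determines `φ(B)`.
theorem calculus_eq_of_eventually_eq (hB : GeneratesBoundedGroup B)
    (hBK : JointSpectrumSubset B K) (hK : IsCompact K) {φ : 𝓢(EuclideanSpace ℝ (Fin n), ℂ)}
    {c : ℂ} (h : ∀ᶠ x in 𝓝ˢ K, φ x = c) : hB.calculus φ = algebraMap ℂ 𝔄 c := by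
  obtain ⟨U, hU, hKU, hφ⟩ := eventually_nhdsSet_iff_exists.1 h
  obtain ⟨χ, hχU, hχ⟩ := exists_schwartzMap_eq_near hK hU hKU
    (contDiffOn_const (c := (1 : ℂ)))
  have hunit : IsUnit (hB.calculus χ) := hB.isUnit_calculus hBK fun x hx => by
    rw [hχ.self_of_nhdsSet x hx]
    exact one_ne_zero
  have hmul : SchwartzMap.smulLeftCLM ℂ χ φ = c • χ := by
    ext x
    rw [SchwartzMap.smulLeftCLM_apply_apply χ.hasTemperateGrowth, smul_apply, smul_eq_mul,
      smul_eq_mul]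
    by_cases hx : x ∈ U
    · rw [hφ x hx, mul_comm]
    · rw [image_eq_zero_of_notMem_tsupport fun h => hx (hχU h), zero_mul, mul_zero]
  refine hunit.mul_left_cancel ?_
  rw [← calculus_smulLeftCLM, hmul, map_smul, Algebra.smul_def, mul_comm]

theorem calculus_congr (hB : GeneratesBoundedGroup B) (hBK : JointSpectrumSubset B K)
    (hK : IsCompact K) {φ ψ : 𝓢(EuclideanSpace ℝ (Fin n), ℂ)} (h : ∀ᶠ x in 𝓝ˢ K, φ x = ψ x) :
    hB.calculus φ = hB.calculus ψ := by
  rw [← sub_eq_zero, ← map_sub, ← map_zero (algebraMap ℂ 𝔄)]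
  refine hB.calculus_eq_of_eventually_eq hBK hK (h.mono fun x hx => ?_)
  rw [sub_apply, hx, sub_self]

/-- The smooth functional calculus as a relation: `g` is smooth and `g(B) = b`, in the sense that
`φ(B) = b` for every Schwartz function `φ` which agrees with `g` near `K`. -/
def HasValue (hB : GeneratesBoundedGroup B) (K : Set (EuclideanSpace ℝ (Fin n)))
    (g : EuclideanSpace ℝ (Fin n) → ℂ) (b : 𝔄) : Prop :=
  ContDiff ℝ ∞ g ∧
    ∀ φ : 𝓢(EuclideanSpace ℝ (Fin n), ℂ), (∀ᶠ x in 𝓝ˢ K, φ x = g x) → hB.calculus φ = b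

theorem hasValue_calculus (hB : GeneratesBoundedGroup B) (hBK : JointSpectrumSubset B K)
    (hK : IsCompact K) {g : EuclideanSpace ℝ (Fin n) → ℂ} (hg : ContDiff ℝ ∞ g)
    {φ : 𝓢(EuclideanSpace ℝ (Fin n), ℂ)} (hφ : ∀ᶠ x in 𝓝ˢ K, φ x = g x) :
    hB.HasValue K g (hB.calculus φ) :=
  ⟨hg, fun ψ hψ => hB.calculus_congr hBK hK (by
    filter_upwards [hφ, hψ] with x h1 h2 using h2.trans h1.symm)⟩

theorem hasValue_one (hB : GeneratesBoundedGroup B) (hBK : JointSpectrumSubset B K)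
    (hK : IsCompact K) : hB.HasValue K 1 1 :=
  ⟨contDiff_const, fun φ hφ => by
    simpa only [map_one] using hB.calculus_eq_of_eventually_eq hBK hK (c := 1) hφ⟩

theorem HasValue.mul {hB : GeneratesBoundedGroup B} (hBK : JointSpectrumSubset B K)
    (hK : IsCompact K) {f g : EuclideanSpace ℝ (Fin n) → ℂ} {a b : 𝔄} (hf : hB.HasValue K f a)
    (hg : hB.HasValue K g b) : hB.HasValue K (f * g) (a * b) := by
  obtain ⟨φ, -, hφ⟩ := exists_schwartzMap_eq_near hK isOpen_univ (subset_univ K) hf.1.contDiffOn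
  obtain ⟨ψ, -, hψ⟩ := exists_schwartzMap_eq_near hK isOpen_univ (subset_univ K) hg.1.contDiffOn
  rw [← hf.2 φ hφ, ← hg.2 ψ hψ, ← hB.calculus_smulLeftCLM]
  refine hB.hasValue_calculus hBK hK (hf.1.mul hg.1) ?_
  filter_upwards [hφ, hψ] with x h1 h2
  rw [SchwartzMap.smulLeftCLM_apply_apply φ.hasTemperateGrowth, h1, h2, smul_eq_mul]

theorem HasValue.pow {hB : GeneratesBoundedGroup B} (hBK : JointSpectrumSubset B K)
    (hK : IsCompact K) {g : EuclideanSpace ℝ (Fin n) → ℂ} {b : 𝔄} (hg : hB.HasValue K g b)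
    (k : ℕ) : hB.HasValue K (g ^ k) (b ^ k) := by
  induction k with
  | zero => simpa only [pow_zero] using hB.hasValue_one hBK hK
  | succ k ih => simpa only [pow_succ] using ih.mul hBK hK hg

theorem HasValue.prod {hB : GeneratesBoundedGroup B} (hBK : JointSpectrumSubset B K)
    (hK : IsCompact K) {ι : Type*} (s : Finset ι) {g : ι → EuclideanSpace ℝ (Fin n) → ℂ}
    {b : ι → 𝔄} (hg : ∀ i ∈ s, hB.HasValue K (g i) (b i)) :
    hB.HasValue K (∏ i ∈ s, g i) (∏ i ∈ s, b i) := by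
  induction s using Finset.cons_induction with
  | empty => simpa only [Finset.prod_empty] using hB.hasValue_one hBK hK
  | cons i s hi ih =>
    simp only [Finset.prod_cons]
    exact (hg i (Finset.mem_cons_self i s)).mul hBK hK
      (ih fun j hj => hg j (Finset.mem_cons_of_mem hj))

theorem hasValue_exp (hB : GeneratesBoundedGroup B) (hBK : JointSpectrumSubset B K)
    (hK : IsCompact K) (τ : EuclideanSpace ℝ (Fin n)) :
    hB.HasValue K (fun x => Complex.exp (Complex.I * (inner ℝ τ x : ℝ))) (jointExp B τ) := by
  have hone := hB.hasValue_one hBK hK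
  obtain ⟨χ, -, hχ⟩ := exists_schwartzMap_eq_near hK isOpen_univ (subset_univ K) hone.1.contDiffOn
  obtain ⟨f, rfl⟩ := (charTransformCLE n).surjective χ
  have hmul := charTransform_compSubConstCLM f τ
  have hvalue := hB.calculus_exp_mul τ hmul
  rw [← charTransformCLE_apply f, hone.2 _ hχ, mul_one] at hvalue
  rw [← hvalue]
  have hsmooth : ContDiff ℝ ∞ fun x => Complex.exp (Complex.I * (inner ℝ τ x : ℝ)) :=
    (contDiff_const.mul (Complex.ofRealCLM ∘L innerSL ℝ τ).contDiff).cexp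
  refine hB.hasValue_calculus hBK hK hsmooth (hχ.mono fun x hx => ?_)
  rw [hmul, ← charTransformCLE_apply, hx, Pi.one_apply, mul_one]

theorem hasValue_inner (hB : GeneratesBoundedGroup B) (hBK : JointSpectrumSubset B K)
    (hK : IsCompact K) (v : EuclideanSpace ℝ (Fin n)) :
    hB.HasValue K (fun x => (inner ℝ v x : ℝ)) (B v) := by
  have hone := hB.hasValue_one hBK hK
  obtain ⟨χ, -, hχ⟩ := exists_schwartzMap_eq_near hK isOpen_univ (subset_univ K) hone.1.contDiffOn
  have hlin : (fun x : EuclideanSpace ℝ (Fin n) => ((inner ℝ v x : ℝ) : ℂ)).HasTemperateGrowth :=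
    (Complex.ofRealCLM ∘L innerSL ℝ v).hasTemperateGrowth
  have hmul := SchwartzMap.smulLeftCLM_apply_apply hlin χ
  have hvalue := hB.calculus_inner_mul v hmul
  rw [hone.2 _ hχ, mul_one] at hvalue
  rw [← hvalue]
  refine hB.hasValue_calculus hBK hK (Complex.ofRealCLM ∘L innerSL ℝ v).contDiff
    (hχ.mono fun x hx => ?_)
  rw [hmul, hx, Pi.one_apply, smul_eq_mul, mul_one]
  rfl

theorem hasValue_monomial (hB : GeneratesBoundedGroup B) (hBK : JointSpectrumSubset B K)
    (hK : IsCompact K) (α : Fin n → ℕ) :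
    hB.HasValue K (fun x => ((∏ j, x j ^ α j : ℝ) : ℂ))
      (∏ j, B (EuclideanSpace.single j 1) ^ α j) := by
  convert HasValue.prod hBK hK Finset.univ fun j _ =>
    (hB.hasValue_inner hBK hK (EuclideanSpace.single j 1)).pow hBK hK (α j) using 1
  ext x
  simp [EuclideanSpace.inner_single_left]

end GeneratesBoundedGroup

end JointCalculus

section Derivatives

theorem lineDeriv_apply_mul_jointExp {E 𝔄 : Type*} [NormedAddCommGroup E] [NormedSpace ℝ E]
    [NormedCommRing 𝔄] [NormedAlgebra ℂ 𝔄] [CompleteSpace 𝔄] (B : E →L[ℝ] 𝔄) (l : 𝔄 →L[ℂ] ℂ)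
    (b : 𝔄) (θ v : E) : lineDeriv ℝ (fun θ => l (b * jointExp B θ)) θ v =
      l (Complex.I • B v * b * jointExp B θ) := by
  have h := ((l ∘L ContinuousLinearMap.mul ℂ 𝔄 b).restrictScalars ℝ).hasFDerivAt.comp θ
    (hasFDerivAt_jointExp B θ)
  refine (h.hasLineDerivAt v).lineDeriv.trans (congrArg l ?_)
  change b * (jointExp B θ * (Complex.I • B v)) = _
  ring

variable {𝔄 : Type*} [NormedCommRing 𝔄] [NormedAlgebra ℂ 𝔄] [CompleteSpace 𝔄] {n : ℕ}

theorem partialDeriv_iterate_jointExp (B : EuclideanSpace ℝ (Fin n) →L[ℝ] 𝔄) (l : 𝔄 →L[ℂ] ℂ)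
    (b : 𝔄) (j : Fin n) (k : ℕ) :
    (partialDeriv j)^[k] (fun θ => l (b * jointExp B θ)) =
      fun θ => l ((Complex.I • B (EuclideanSpace.single j 1)) ^ k * b * jointExp B θ) := by
  induction k with
  | zero => simp
  | succ k ih =>
    rw [Function.iterate_succ_apply', ih]
    ext θ
    rw [partialDeriv, lineDeriv_apply_mul_jointExp, pow_succ', mul_assoc _ _ b]

theorem mixedPartialDeriv_jointExp (B : EuclideanSpace ℝ (Fin n) →L[ℝ] 𝔄) (l : 𝔄 →L[ℂ] ℂ)
    (α : Fin n → ℕ) : mixedPartialDeriv α (fun θ => l (jointExp B θ)) = fun θ =>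
      l ((∏ j, (Complex.I • B (EuclideanSpace.single j 1)) ^ α j) * jointExp B θ) := by
  have hfoldr : ∀ L : List (Fin n), L.foldr (fun j g => (partialDeriv j)^[α j] g)
      (fun θ => l (jointExp B θ)) = fun θ =>
        l ((L.map fun j => (Complex.I • B (EuclideanSpace.single j 1)) ^ α j).prod *
          jointExp B θ) := by
    intro L
    induction L with
    | nil => simp
    | cons j L ih =>
      rw [List.foldr_cons, ih, partialDeriv_iterate_jointExp, List.map_cons, List.prod_cons]
  rw [mixedPartialDeriv, hfoldr, ← Fin.prod_univ_def]

theorem mixedPartialDeriv_jointExp_zero (B : EuclideanSpace ℝ (Fin n) →L[ℝ] 𝔄) (l : 𝔄 →L[ℂ] ℂ)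
    (α : Fin n → ℕ) :
    (1 / Complex.I ^ (∑ j, α j)) * mixedPartialDeriv α (fun θ => l (jointExp B θ)) 0 =
      l (∏ j, B (EuclideanSpace.single j 1) ^ α j) := by
  simp only [mixedPartialDeriv_jointExp, jointExp_zero, mul_one, smul_pow]
  rw [Finset.prod_smul, Finset.prod_pow_eq_pow_sum, map_smul, smul_eq_mul, ← mul_assoc,
    one_div, inv_mul_cancel₀ (pow_ne_zero _ Complex.I_ne_zero), one_mul]

end Derivatives

section CalculusDistribution

variable {𝔄 : Type*} [NormedCommRing 𝔄] [NormedAlgebra ℂ 𝔄] [CompleteSpace 𝔄] {n : ℕ}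
  {B : EuclideanSpace ℝ (Fin n) →L[ℝ] 𝔄} {K : Set (EuclideanSpace ℝ (Fin n))}

namespace GeneratesBoundedGroup

/-- The tempered distribution `φ ↦ l(φ(B))`: the quasi-probability distribution of the family `B`
in the state `l`. -/
def distribution (hB : GeneratesBoundedGroup B) (l : 𝔄 →L[ℂ] ℂ) :
    𝓢'(EuclideanSpace ℝ (Fin n), ℂ) :=
  ContinuousLinearMap.toPointwiseConvergenceCLM ℂ (RingHom.id ℂ) _ _ (l ∘L hB.calculus)

theorem distribution_apply (hB : GeneratesBoundedGroup B) (l : 𝔄 →L[ℂ] ℂ)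
    (φ : 𝓢(EuclideanSpace ℝ (Fin n), ℂ)) : hB.distribution l φ = l (hB.calculus φ) := rfl

theorem isFourierTransform_distribution (hB : GeneratesBoundedGroup B) (l : 𝔄 →L[ℂ] ℂ) :
    IsFourierTransform (hB.distribution l) fun θ => l (jointExp B θ) := fun f => by
  rw [distribution_apply, calculus_charTransform, apply_smear]
  simp only [smul_eq_mul, mul_comm]

theorem dsupport_distribution_subset (hB : GeneratesBoundedGroup B)
    (hBK : JointSpectrumSubset B K) (hK : IsCompact K) (l : 𝔄 →L[ℂ] ℂ) :
    Distribution.dsupport (hB.distribution l) ⊆ K := by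
  refine sInter_subset_of_mem ⟨fun φ hφ => ?_, hK.isClosed⟩
  have hzero : ∀ᶠ x in 𝓝ˢ K, φ x = (0 : 𝓢(EuclideanSpace ℝ (Fin n), ℂ)) x :=
    eventually_nhdsSet_iff_forall.2 fun x hx =>
      notMem_tsupport_iff_eventuallyEq.1 fun h => hφ h hx
  rw [distribution_apply, hB.calculus_congr hBK hK hzero, map_zero, map_zero]

theorem isCompactlySupported_distribution (hB : GeneratesBoundedGroup B)
    (hBK : JointSpectrumSubset B K) (hK : IsCompact K) (l : 𝔄 →L[ℂ] ℂ) :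
    IsCompactlySupported (hB.distribution l) :=
  hK.of_isClosed_subset Distribution.isClosed_dsupport (hB.dsupport_distribution_subset hBK hK l)

theorem HasValue.hasIntegral {hB : GeneratesBoundedGroup B} (hBK : JointSpectrumSubset B K)
    (hK : IsCompact K) {g : EuclideanSpace ℝ (Fin n) → ℂ} {b : 𝔄} (hg : hB.HasValue K g b)
    (l : 𝔄 →L[ℂ] ℂ) : HasIntegral (hB.distribution l) g (l b) := by
  obtain ⟨ψ, -, hψ⟩ := exists_schwartzMap_eq_near hK isOpen_univ (subset_univ K) hg.1.contDiffOn
  have hψ' := hψ.filter_mono (nhdsSet_mono (hB.dsupport_distribution_subset hBK hK l))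
  refine ⟨⟨ψ, hψ'⟩, fun φ hφ => ?_⟩
  rw [← hg.2 ψ hψ, ← distribution_apply]
  refine apply_congr_of_eventually_eq _ ?_
  filter_upwards [hφ, hψ'] with x h1 h2 using h1.trans h2.symm

theorem hasIntegral_monomial_distribution (hB : GeneratesBoundedGroup B)
    (hBK : JointSpectrumSubset B K) (hK : IsCompact K) (l : 𝔄 →L[ℂ] ℂ) (α : Fin n → ℕ) :
    HasIntegral (hB.distribution l) (fun x => ((∏ j, x j ^ α j : ℝ) : ℂ))
      ((1 / Complex.I ^ (∑ j, α j)) * mixedPartialDeriv α (fun θ => l (jointExp B θ)) 0) := by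
  rw [mixedPartialDeriv_jointExp_zero]
  exact (hB.hasValue_monomial hBK hK α).hasIntegral hBK hK l

end GeneratesBoundedGroup

end CalculusDistribution

section CommutativeSubalgebra

theorem inv_mem_centralizer_of_unit {M : Type*} [Monoid M] {S : Set M} {u : Mˣ}
    (h : (u : M) ∈ S.centralizer) : (↑u⁻¹ : M) ∈ S.centralizer := fun x hx =>
  Commute.units_inv_right (show Commute x u from h x hx)

-- The subalgebra is the bicommutant of the family.
theorem exists_commutative_subalgebra {𝔅 : Type*} [NormedRing 𝔅] [NormedAlgebra ℂ 𝔅]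
    [CompleteSpace 𝔅] {ι : Type*} {a : ι → 𝔅} (ha : ∀ i j, Commute (a i) (a j)) :
    ∃ 𝔄 : Subalgebra ℂ 𝔅, (∀ x y : 𝔄, x * y = y * x) ∧ CompleteSpace 𝔄 ∧
      ∃ b : ι → 𝔄, (∀ i, (b i : 𝔅) = a i) ∧ ∀ i, spectrum ℂ (b i) = spectrum ℂ (a i) := by
  let 𝔄 := Subalgebra.centralizer ℂ (range a).centralizer
  let b (i : ι) : 𝔄 := ⟨a i, subset_centralizer_centralizer (mem_range_self i)⟩
  have hcomm : ∀ x ∈ range a, ∀ y ∈ range a, x * y = y * x := by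
    rintro _ ⟨i, rfl⟩ _ ⟨j, rfl⟩
    exact ha i j
  refine ⟨𝔄, fun x y => Subtype.ext ?_, ?_, b, fun i => rfl, fun i => subset_antisymm
    (fun z => mt fun hz => ?_) (AlgHom.spectrum_apply_subset 𝔄.val (b i))⟩
  · exact centralizer_centralizer_comm_of_comm hcomm x x.2 y y.2
  · exact (isClosed_centralizer (range a).centralizer).completeSpace_coe
  · obtain ⟨u, hu⟩ := hz
    have huinv : (↑u⁻¹ : 𝔅) ∈ 𝔄 := inv_mem_centralizer_of_unit
      (hu ▸ (algebraMap ℂ 𝔄 z - b i).2)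
    refine ⟨⟨algebraMap ℂ 𝔄 z - b i, ⟨_, huinv⟩, Subtype.ext ?_, Subtype.ext ?_⟩, rfl⟩
    · exact (congrArg (· * (↑u⁻¹ : 𝔅)) hu).symm.trans u.mul_inv
    · exact (congrArg ((↑u⁻¹ : 𝔅) * ·) hu).symm.trans u.inv_mul

end CommutativeSubalgebra

section MultiplicativeMultilinear

universe u

variable {R 𝔅 ι : Type*} [NormedRing R] [NormedAlgebra ℂ R] [NormedRing 𝔅] [NormedAlgebra ℂ 𝔅]
  [DecidableEq ι]

/-- A multiplicative multilinear map, restricted to one of its variables while the others are equal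
to `1`, is a homomorphism of algebras. -/
def mulSingleAlgHom (m : ContinuousMultilinearMap ℂ (fun _ : ι => R) 𝔅) (hone : m 1 = 1)
    (hmul : ∀ X Y : ι → R, m (X * Y) = m X * m Y) (i : ι) : R →ₐ[ℂ] 𝔅 :=
  AlgHom.ofLinearMap (m.toContinuousLinearMap 1 i).toLinearMap
    ((congrArg m (Pi.mulSingle_one (M := fun _ => R) i)).trans hone)
    fun x y => (congrArg m (Pi.mulSingle_mul (f := fun _ => R) i x y)).trans (hmul _ _)

theorem mulSingleAlgHom_apply (m : ContinuousMultilinearMap ℂ (fun _ : ι => R) 𝔅) (hone : m 1 = 1)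
    (hmul : ∀ X Y : ι → R, m (X * Y) = m X * m Y) (i : ι) (x : R) :
    mulSingleAlgHom m hone hmul i x = m (Pi.mulSingle i x) := rfl

theorem commute_mulSingleAlgHom (m : ContinuousMultilinearMap ℂ (fun _ : ι => R) 𝔅)
    (hone : m 1 = 1) (hmul : ∀ X Y : ι → R, m (X * Y) = m X * m Y) {i j : ι} (hij : i ≠ j)
    (x y : R) :
    Commute (mulSingleAlgHom m hone hmul i x) (mulSingleAlgHom m hone hmul j y) := by
  rw [mulSingleAlgHom_apply, mulSingleAlgHom_apply, Commute, SemiconjBy, ← hmul, ← hmul]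
  exact congrArg m (Pi.mulSingle_commute (f := fun _ => R) hij x y).eq

theorem exp_sum_mulSingleAlgHom [CompleteSpace R] [CompleteSpace 𝔅] [Fintype ι]
    (m : ContinuousMultilinearMap ℂ (fun _ : ι => R) 𝔅) (hone : m 1 = 1)
    (hmul : ∀ X Y : ι → R, m (X * Y) = m X * m Y) (X : ι → R) :
    NormedSpace.exp (∑ i, mulSingleAlgHom m hone hmul i (X i)) =
      m fun i => NormedSpace.exp (X i) := by
  let _ := NormedAlgebra.restrictScalars ℚ ℂ R
  let _ := NormedAlgebra.restrictScalars ℚ ℂ 𝔅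
  let mHom : (ι → R) →* 𝔅 := ⟨⟨m, hone⟩, hmul⟩
  have hprod := Finset.map_noncommProd Finset.univ
    (fun i => (Pi.mulSingle i (NormedSpace.exp (X i)) : ι → R))
    (fun i _ j _ _ => Pi.mulSingle_apply_commute (fun i => NormedSpace.exp (X i)) i j) mHom
  rw [Finset.noncommProd_mulSingle] at hprod
  rw [NormedSpace.exp_sum_of_commute Finset.univ _ fun i _ j _ hij =>
    commute_mulSingleAlgHom m hone hmul hij (X i) (X j)]
  refine (Finset.noncommProd_congr rfl (fun i _ => ?_) _).trans hprod.symm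
  exact (NormedSpace.map_exp (mulSingleAlgHom m hone hmul i)
    (m.toContinuousLinearMap 1 i).continuous (X i)).symm

omit [DecidableEq ι] in
theorem exists_commutative_exp_sum_eq {𝔅 : Type u} [NormedRing 𝔅] [NormedAlgebra ℂ 𝔅]
    [CompleteSpace R] [CompleteSpace 𝔅] [Fintype ι]
    (m : ContinuousMultilinearMap ℂ (fun _ : ι => R) 𝔅) (hone : m 1 = 1)
    (hmul : ∀ X Y : ι → R, m (X * Y) = m X * m Y) (a : ι → R) :
    ∃ (𝔄 : Type u) (_ : NormedCommRing 𝔄) (_ : NormedAlgebra ℂ 𝔄) (_ : CompleteSpace 𝔄)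
      (b : ι → 𝔄) (J : 𝔄 →L[ℂ] 𝔅) (M : ℝ), (∀ i, spectrum ℂ (b i) ⊆ spectrum ℂ (a i)) ∧
      ∀ c : ι → ℂ, ‖NormedSpace.exp (∑ i, c i • b i)‖ ≤ M * ∏ i, ‖NormedSpace.exp (c i • a i)‖ ∧
        J (NormedSpace.exp (∑ i, c i • b i)) = m fun i => NormedSpace.exp (c i • a i) := by
  classical
  let h := mulSingleAlgHom m hone hmul
  have hcomm : ∀ i j, Commute (h i (a i)) (h j (a j)) := fun i j => by
    rcases eq_or_ne i j with rfl | hij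
    · exact Commute.refl _
    · exact commute_mulSingleAlgHom m hone hmul hij _ _
  obtain ⟨𝔄, hmul𝔄, hcomp, b, hb, hspec⟩ := exists_commutative_subalgebra hcomm
  let _ : NormedCommRing 𝔄 := { (inferInstance : NormedRing 𝔄) with mul_comm := hmul𝔄 }
  have hexp : ∀ c : ι → ℂ, 𝔄.val (NormedSpace.exp (∑ i, c i • b i)) =
      m fun i => NormedSpace.exp (c i • a i) := fun c => by
    let _ := NormedAlgebra.restrictScalars ℚ ℂ 𝔄
    let _ := NormedAlgebra.restrictScalars ℚ ℂ 𝔅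
    rw [NormedSpace.map_exp 𝔄.val continuous_subtype_val, ← exp_sum_mulSingleAlgHom m hone hmul,
      map_sum]
    refine congrArg _ (Finset.sum_congr rfl fun i _ => ?_)
    rw [map_smul, map_smul]
    exact congrArg _ (hb i)
  refine ⟨𝔄, inferInstance, inferInstance, hcomp, b, 𝔄.toSubmodule.subtypeL, ‖m‖,
    fun i => (hspec i).trans_subset (AlgHom.spectrum_apply_subset (h i) (a i)),
    fun c => ⟨?_, hexp c⟩⟩
  exact (congrArg norm (hexp c)).trans_le (m.le_opNorm _)

end MultiplicativeMultilinear

section CommutativeModel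

universe u

variable {R F ι : Type*} [NormedRing R] [NormedAlgebra ℂ R] [NormedAddCommGroup F]
  [NormedSpace ℂ F] [Fintype ι]

variable (R F ι) in
/-- The Banach algebra of bounded operators on the Banach space of bounded multilinear maps
`R × ⋯ × R → F`. -/
abbrev SlotOperator : Type _ :=
  ContinuousMultilinearMap ℂ (fun _ : ι => R) F →L[ℂ] ContinuousMultilinearMap ℂ (fun _ : ι => R) F

variable (R F ι) in
/-- Right multiplication in each of the variables of a multilinear map, `Φ ↦ Φ(· X)`, as an
operator which depends multilinearly on `X`. -/
def slotMul : ContinuousMultilinearMap ℂ (fun _ : ι => R) (SlotOperator R F ι) :=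
  (ContinuousMultilinearMap.compContinuousLinearMapContinuousMultilinear ℂ _ _
    F).compContinuousLinearMap fun _ => (ContinuousLinearMap.mul ℂ R).flip

theorem slotMul_apply_apply (X Y : ι → R) (Φ : ContinuousMultilinearMap ℂ (fun _ : ι => R) F) :
    slotMul R F ι X Φ Y = Φ (Y * X) := rfl

theorem slotMul_one : slotMul R F ι 1 = 1 := by
  ext Φ Y
  rw [slotMul_apply_apply, mul_one, one_apply_eq_self]

theorem slotMul_mul (X Y : ι → R) : slotMul R F ι (X * Y) = slotMul R F ι X * slotMul R F ι Y := by
  ext Φ Z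
  exact congrArg Φ (mul_assoc Z X Y).symm

theorem exists_commutative_model {R : Type u} [NormedRing R] [NormedAlgebra ℂ R] [CompleteSpace R]
    {ι : Type} [Fintype ι] (Φ : ContinuousMultilinearMap ℂ (fun _ : ι => R) ℂ) (a : ι → R) :
    ∃ (𝔄 : Type u) (_ : NormedCommRing 𝔄) (_ : NormedAlgebra ℂ 𝔄) (_ : CompleteSpace 𝔄)
      (b : ι → 𝔄) (l : 𝔄 →L[ℂ] ℂ) (M : ℝ), (∀ i, spectrum ℂ (b i) ⊆ spectrum ℂ (a i)) ∧
      ∀ c : ι → ℂ, ‖NormedSpace.exp (∑ i, c i • b i)‖ ≤ M * ∏ i, ‖NormedSpace.exp (c i • a i)‖ ∧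
        l (NormedSpace.exp (∑ i, c i • b i)) = Φ fun i => NormedSpace.exp (c i • a i) := by
  classical
  obtain ⟨𝔄, _, _, _, b, J, M, hspec, hexp⟩ :=
    exists_commutative_exp_sum_eq (𝔅 := SlotOperator R ℂ ι) (slotMul R ℂ ι) slotMul_one
      slotMul_mul a
  refine ⟨𝔄, inferInstance, inferInstance, inferInstance, b,
    ContinuousMultilinearMap.apply ℂ (fun _ : ι => R) ℂ 1 ∘L ContinuousLinearMap.apply ℂ _ Φ ∘L J,
    M, hspec, fun c => ⟨(hexp c).1, ?_⟩⟩
  refine (congrArg (fun T : SlotOperator R ℂ ι => T Φ 1) (hexp c).2).trans ?_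
  rw [slotMul_apply_apply, one_mul]

end CommutativeModel

section SelfAdjointModel

universe u

theorem norm_exp_I_mul_smul_le {R : Type*} [CStarAlgebra R] {a : R} (ha : IsSelfAdjoint a)
    (t : ℝ) : ‖NormedSpace.exp ((Complex.I * (t : ℂ)) • a)‖ ≤ 1 := by
  let _ := NormedAlgebra.restrictScalars ℚ ℂ R
  rcases subsingleton_or_nontrivial R with _ | _
  · exact (norm_of_subsingleton _).trans_le zero_le_one
  · refine (CStarRing.norm_of_mem_unitary (NormedSpace.exp_mem_unitary_of_mem_skewAdjoint ?_)).le
    rw [skewAdjoint.mem_iff, star_smul, ha.star_eq, Complex.star_def, map_mul, Complex.conj_I,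
      Complex.conj_ofReal, neg_mul, neg_smul]

theorem exists_jointExp_eq {R : Type u} [CStarAlgebra R] {ι : Type} [Fintype ι] {n : ℕ}
    (Φ : ContinuousMultilinearMap ℂ (fun _ : ι => R) ℂ) {a : ι → R}
    (ha : ∀ i, IsSelfAdjoint (a i)) (v : ι → EuclideanSpace ℝ (Fin n)) :
    ∃ (𝔄 : Type u) (_ : NormedCommRing 𝔄) (_ : NormedAlgebra ℂ 𝔄) (_ : CompleteSpace 𝔄)
      (B : EuclideanSpace ℝ (Fin n) →L[ℝ] 𝔄) (l : 𝔄 →L[ℂ] ℂ), GeneratesBoundedGroup B ∧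
      JointSpectrumSubset B ((fun s => ∑ i, s i • v i) '' univ.pi fun i => spectrum ℝ (a i)) ∧
      ∀ θ, Φ (fun i => NormedSpace.exp ((Complex.I * (inner ℝ (v i) θ : ℝ)) • a i)) =
        l (jointExp B θ) := by
  obtain ⟨𝔄, _, _, _, b, l, M, hspec, hexp⟩ := exists_commutative_model Φ a
  let B : EuclideanSpace ℝ (Fin n) →L[ℝ] 𝔄 := ∑ i, (innerSL ℝ (v i)).smulRight (b i)
  have hB : ∀ θ, B θ = ∑ i, (inner ℝ (v i) θ : ℝ) • b i := fun θ => by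
    simp only [B, sum_apply, ContinuousLinearMap.smulRight_apply, innerSL_apply_apply]
  have hjoint : ∀ θ, jointExp B θ =
      NormedSpace.exp (∑ i, (Complex.I * (inner ℝ (v i) θ : ℝ)) • b i) := fun θ => by
    simp only [jointExp, hB, Finset.smul_sum, mul_smul, Complex.coe_smul]
  refine ⟨𝔄, inferInstance, inferInstance, inferInstance, B, l, ⟨|M|, fun θ => ?_⟩, fun χ => ?_,
    fun θ => (hexp _).2.symm.trans (congrArg l (hjoint θ).symm)⟩
  · rw [hjoint]
    refine (hexp _).1.trans ((mul_le_mul_of_nonneg_right (le_abs_self M)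
      (Finset.prod_nonneg fun _ _ => norm_nonneg _)).trans ?_)
    exact mul_le_of_le_one_right (abs_nonneg M) (Finset.prod_le_one (fun _ _ => norm_nonneg _)
      fun i _ => norm_exp_I_mul_smul_le (ha i) _)
  · have hreal : ∀ i, ∃ x ∈ spectrum ℝ (a i), χ (b i) = (x : ℂ) := fun i => by
      have hχ : χ (b i) ∈ spectrum ℂ (a i) :=
        hspec i (AlgHom.apply_mem_spectrum (WeakDual.CharacterSpace.toAlgHom χ) (b i))
      have hre := (ha i).mem_spectrum_eq_re hχ
      exact ⟨(χ (b i)).re, (spectrum.algebraMap_mem_iff ℂ).1 (hre ▸ hχ), hre⟩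
    choose x hx hχ using hreal
    refine ⟨_, ⟨x, fun i _ => hx i, rfl⟩, fun θ => ?_⟩
    rw [hB, map_sum, inner_sum, Complex.ofReal_sum]
    refine Finset.sum_congr rfl fun i _ => ?_
    rw [← Complex.coe_smul, map_smul, hχ, inner_smul_right, real_inner_comm, smul_eq_mul,
      Complex.ofReal_mul, mul_comm]

end SelfAdjointModel

section Ampliation

variable {H : Type*} [NormedAddCommGroup H] [InnerProductSpace ℂ H] [CompleteSpace H]

theorem ampliation_coe (X : H →L[ℂ] H) (x : H ⊗[ℂ] BraSpace H) :
    ampliation X (x : HilbertTensorDual H) =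
      ((X.rTensor (BraSpace H) x : H ⊗[ℂ] BraSpace H) : HilbertTensorDual H) :=
  ContinuousLinearMap.completion_apply_coe _ _

theorem ampliation_one (Φ : HilbertTensorDual H) : ampliation (1 : H →L[ℂ] H) Φ = Φ := by
  induction Φ using UniformSpace.Completion.induction_on with
  | hp => exact isClosed_eq (ampliation (1 : H →L[ℂ] H)).continuous continuous_id
  | ih x => rw [ampliation_coe, ContinuousLinearMap.rTensor_one, one_apply_eq_self]

theorem ampliation_add (X Y : H →L[ℂ] H) (Φ : HilbertTensorDual H) :
    ampliation (X + Y) Φ = ampliation X Φ + ampliation Y Φ := by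
  induction Φ using UniformSpace.Completion.induction_on with
  | hp =>
    exact isClosed_eq (ampliation (X + Y)).continuous
      ((ampliation X).continuous.add (ampliation Y).continuous)
  | ih x =>
    rw [ampliation_coe, ampliation_coe, ampliation_coe, ContinuousLinearMap.rTensor_add,
      add_apply, UniformSpace.Completion.coe_add]

theorem ampliation_smul (c : ℂ) (X : H →L[ℂ] H) (Φ : HilbertTensorDual H) :
    ampliation (c • X) Φ = c • ampliation X Φ := by
  induction Φ using UniformSpace.Completion.induction_on with
  | hp =>
    exact isClosed_eq (ampliation (c • X)).continuous ((ampliation X).continuous.const_smul c)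
  | ih x =>
    rw [ampliation_coe, ampliation_coe, ContinuousLinearMap.rTensor_smul, smul_apply,
      UniformSpace.Completion.coe_smul]

theorem norm_ampliation_apply_le (X : H →L[ℂ] H) (Φ : HilbertTensorDual H) :
    ‖ampliation X Φ‖ ≤ ‖X‖ * ‖Φ‖ := by
  induction Φ using UniformSpace.Completion.induction_on with
  | hp => exact isClosed_le (ampliation X).continuous.norm (continuous_const.mul continuous_norm)
  | ih x =>
    rw [ampliation_coe, UniformSpace.Completion.norm_coe, UniformSpace.Completion.norm_coe]
    exact (ContinuousLinearMap.le_opNorm _ _).trans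
      (mul_le_mul_of_nonneg_right (ContinuousLinearMap.norm_rTensor_le _ _) (norm_nonneg _))

/-- The functional `X ↦ ⟨Ψ|X ⊗ 1|Ψ⟩`; for a purification `Ψ` of `ρ` it is the expectation in the
state `ρ`. -/
def purificationExpectation (Ψ : HilbertTensorDual H) : (H →L[ℂ] H) →L[ℂ] ℂ :=
  innerSL ℂ Ψ ∘L LinearMap.mkContinuous
    { toFun := fun X => ampliation X Ψ
      map_add' := fun X Y => ampliation_add X Y Ψ
      map_smul' := fun c X => ampliation_smul c X Ψ }
    ‖Ψ‖ fun X => (norm_ampliation_apply_le X Ψ).trans_eq (mul_comm _ _)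

theorem purificationExpectation_apply (Ψ : HilbertTensorDual H) (X : H →L[ℂ] H) :
    purificationExpectation Ψ X = inner ℂ Ψ (ampliation X Ψ) := rfl

end Ampliation

section Ordering

universe u

variable {n : ℕ}

/-- The polarized ordering `(Y_{r,k}) ↦ ∏_r ∑_σ w(σ) Y_{r,σ(1)} ⋯ Y_{r,σ(n)}`, in which the `N`
factors of the power have independent variables. -/
def polarizedOrdering (R : Type*) [NormedRing R] [NormedAlgebra ℂ R] (N : ℕ)
    (w : Equiv.Perm (Fin n) → ℂ) :
    ContinuousMultilinearMap ℂ (fun _ : (Σ _ : Fin N, Fin n) => R) R where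
  toMultilinearMap := (MultilinearMap.mkPiAlgebraFin ℂ N R).compMultilinearMap fun _ =>
    ∑ σ : Equiv.Perm (Fin n), w σ • (MultilinearMap.mkPiAlgebraFin ℂ n R).domDomCongr σ
  cont := by
    let factor : ContinuousMultilinearMap ℂ (fun _ : Fin n => R) R :=
      ∑ σ : Equiv.Perm (Fin n), w σ • (ContinuousMultilinearMap.mkPiAlgebraFin ℂ n R).domDomCongr σ
    have hfactor : ∀ y, (∑ σ : Equiv.Perm (Fin n),
        w σ • (MultilinearMap.mkPiAlgebraFin ℂ n R).domDomCongr σ) y = factor y := fun y => by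
      simp only [factor, sum_apply, smul_apply]
      rfl
    refine (ContinuousMultilinearMap.mkPiAlgebraFin ℂ N R).cont.comp (continuous_pi fun r => ?_)
    simp only [hfactor]
    exact factor.cont.comp (continuous_pi fun k => continuous_apply _)

theorem polarizedOrdering_apply {R : Type*} [NormedRing R] [NormedAlgebra ℂ R] (N : ℕ)
    (w : Equiv.Perm (Fin n) → ℂ) (Y : Fin n → R) :
    polarizedOrdering R N w (fun p => Y p.2) =
      (∑ σ, w σ • (List.ofFn fun j => Y (σ j)).prod) ^ N := by
  change MultilinearMap.mkPiAlgebraFin ℂ N R (fun _ => (∑ σ : Equiv.Perm (Fin n),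
    w σ • (MultilinearMap.mkPiAlgebraFin ℂ n R).domDomCongr σ) Y) = _
  simp only [sum_apply, smul_apply, MultilinearMap.domDomCongr_apply,
    MultilinearMap.mkPiAlgebraFin_apply, List.ofFn_const, List.prod_replicate]

theorem image_average_smul_single (N : ℕ) (S : Fin n → Set ℝ) :
    (fun s : (Σ _ : Fin N, Fin n) → ℝ =>
      ∑ p, s p • (N : ℝ)⁻¹ • EuclideanSpace.single p.2 (1 : ℝ)) '' (univ.pi fun p => S p.2) =
      {x | ∀ j, x j ∈ averages N (S j)} := by
  have hcoord : ∀ (s : (Σ _ : Fin N, Fin n) → ℝ) (j : Fin n),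
      (∑ p, s p • (N : ℝ)⁻¹ • EuclideanSpace.single p.2 (1 : ℝ)) j = (∑ r, s ⟨r, j⟩) / N := by
    intro s j
    simp [Fintype.sum_sigma, div_eq_mul_inv, Pi.single_apply, Finset.sum_mul]
  ext x
  constructor
  · rintro ⟨s, hs, rfl⟩ j
    exact ⟨fun r => s ⟨r, j⟩, fun r => hs ⟨r, j⟩ (mem_univ _), hcoord s j⟩
  · intro hx
    choose s hs hxs using hx
    exact ⟨fun p => s p.2 p.1, fun p _ => hs p.2 p.1,
      PiLp.ext fun j => (hcoord _ j).trans (hxs j).symm⟩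

variable {H : Type u} [NormedAddCommGroup H] [InnerProductSpace ℂ H] [CompleteSpace H]

theorem isCompact_pi_averages_spectrum (A : Fin n → H →L[ℂ] H) (N : ℕ) :
    IsCompact {x : EuclideanSpace ℝ (Fin n) | ∀ j, x j ∈ averages N (spectrum ℝ (A j))} := by
  have hcompact : IsCompact (univ.pi fun p : (Σ _ : Fin N, Fin n) => spectrum ℝ (A p.2)) :=
    isCompact_univ_pi fun p => spectrum.isCompact (A p.2)
  refine image_average_smul_single N (fun j => spectrum ℝ (A j)) ▸ hcompact.image ?_
  exact continuous_finsetSum _ fun p _ => (continuous_apply p).smul continuous_const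

theorem qcf_eq_polarizedOrdering_exp (A : Fin n → H →L[ℂ] H) (N : ℕ)
    (w : Equiv.Perm (Fin n) → ℂ) (Ψ : HilbertTensorDual H) (θ : EuclideanSpace ℝ (Fin n)) :
    qcf A N w Ψ θ = purificationExpectation Ψ (polarizedOrdering (H →L[ℂ] H) N w fun p =>
      NormedSpace.exp ((Complex.I *
        (inner ℝ ((N : ℝ)⁻¹ • EuclideanSpace.single p.2 (1 : ℝ)) θ : ℝ)) • A p.2)) := by
  rw [qcf, ← purificationExpectation_apply, unitaryOrdering, ← polarizedOrdering_apply N w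
    fun j => NormedSpace.exp ((Complex.I * (θ j : ℂ) / (N : ℂ)) • A j)]
  refine congrArg (fun Y => purificationExpectation Ψ (polarizedOrdering _ N w Y))
    (funext fun p => ?_)
  simp [EuclideanSpace.inner_single_left, div_eq_mul_inv, inner_smul_left, mul_comm,
    mul_left_comm]

theorem exists_jointExp_eq_qcf {A : Fin n → H →L[ℂ] H} (hA : ∀ j, IsSelfAdjoint (A j))
    (N : ℕ) (w : Equiv.Perm (Fin n) → ℂ) (Ψ : HilbertTensorDual H) :
    ∃ (𝔄 : Type u) (_ : NormedCommRing 𝔄) (_ : NormedAlgebra ℂ 𝔄) (_ : CompleteSpace 𝔄)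
      (B : EuclideanSpace ℝ (Fin n) →L[ℝ] 𝔄) (l : 𝔄 →L[ℂ] ℂ), GeneratesBoundedGroup B ∧
      JointSpectrumSubset B {x | ∀ j, x j ∈ averages N (spectrum ℝ (A j))} ∧
      qcf A N w Ψ = fun θ => l (jointExp B θ) := by
  obtain ⟨𝔄, _, _, _, B, l, hB, hBK, hl⟩ := exists_jointExp_eq
    ((purificationExpectation Ψ).compContinuousMultilinearMap (polarizedOrdering (H →L[ℂ] H) N w))
    (fun p : (Σ _ : Fin N, Fin n) => hA p.2)
    fun p => (N : ℝ)⁻¹ • EuclideanSpace.single p.2 (1 : ℝ)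
  exact ⟨𝔄, inferInstance, inferInstance, inferInstance, B, l, hB,
    image_average_smul_single N (fun j => spectrum ℝ (A j)) ▸ hBK,
    funext fun θ => (qcf_eq_polarizedOrdering_exp A N w Ψ θ).trans (hl θ)⟩

end Ordering

section PurificationNorm

universe u

variable {H : Type u} [NormedAddCommGroup H] [InnerProductSpace ℂ H] {ι : Type*} {α : ι → H}

theorem hasSum_inner_self_of_orthonormal (hα : Orthonormal ℂ α) {c : ι → ℂ} {x : H}
    (hx : HasSum (fun i => c i • α i) x) : HasSum (fun i => conj (c i) * c i) (inner ℂ x x) := by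
  classical
  have hcoeff : ∀ i, inner ℂ (α i) x = c i := fun i => by
    refine (hx.mapL (innerSL ℂ (α i))).unique ((hasSum_ite_eq i (c i)).congr_fun fun j => ?_)
    rcases eq_or_ne j i with rfl | hji
    · rw [innerSL_apply_apply, inner_smul_right, orthonormal_iff_ite.1 hα, if_pos rfl, if_pos rfl,
        mul_one]
    · rw [innerSL_apply_apply, inner_smul_right, hα.2 hji.symm, if_neg hji, mul_zero]
  refine (hx.mapL (innerSL ℂ x)).congr_fun fun i => ?_
  rw [innerSL_apply_apply, inner_smul_right, ← inner_conj_symm, hcoeff, mul_comm]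

theorem apply_of_hasSum_orthonormal (hα : Orthonormal ℂ α) {c : ι → ℂ} {ρ : H → H}
    (hρ : ∀ x, HasSum (fun i => c i • inner ℂ (α i) x • α i) (ρ x)) (i : ι) :
    ρ (α i) = c i • α i := by
  classical
  refine (hρ (α i)).unique ((hasSum_ite_eq i (c i • α i)).congr_fun fun j => ?_)
  rcases eq_or_ne j i with rfl | hji
  · rw [orthonormal_iff_ite.1 hα, if_pos rfl, if_pos rfl, one_smul]
  · rw [hα.2 hji, if_neg hji, zero_smul, smul_zero]

variable [CompleteSpace H]

theorem exists_hilbertBasis_hasSum_inner_apply_iff (hα : Orthonormal ℂ α) {c : ι → ℂ} {ρ : H → H}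
    (hρ : ∀ x, HasSum (fun i => c i • inner ℂ (α i) x • α i) (ρ x)) :
    ∃ (κ : Type u) (b : HilbertBasis κ ℂ H), ∀ t : ℂ,
      HasSum (fun k => inner ℂ (b k) (ρ (b k))) t ↔ HasSum c t := by
  obtain ⟨s, b, hs, hb⟩ := Orthonormal.exists_hilbertBasis_extension hα.toSubtypeRange
  let f (i : ι) : s := ⟨α i, hs ⟨i, rfl⟩⟩
  have hbf : ∀ i, b (f i) = α i := fun i => congrFun hb (f i)
  have hf : Function.Injective f := fun i j h =>
    hα.linearIndependent.injective (congrArg Subtype.val h)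
  refine ⟨s, b, fun t => ?_⟩
  rw [← hf.hasSum_iff fun k hk => ?_]
  · refine iff_of_eq (congrArg (HasSum · t) (funext fun i => ?_))
    rw [Function.comp_apply, hbf, apply_of_hasSum_orthonormal hα hρ, inner_smul_right,
      inner_self_eq_norm_sq_to_K, hα.1 i]
    simp
  · have hρk : ρ (b k) = 0 := (hρ (b k)).unique (hasSum_zero.congr_fun fun i => by
      rw [← hbf i, b.orthonormal.2 fun h => hk ⟨i, h⟩, zero_smul, smul_zero])
    rw [hρk, inner_zero_right]

theorem orthonormal_ketBra (hα : Orthonormal ℂ α) :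
    Orthonormal ℂ fun i => ketBra (α i) (α i) := by
  classical
  refine orthonormal_iff_ite.2 fun i j => ?_
  rw [ketBra, ketBra, UniformSpace.Completion.inner_coe, TensorProduct.inner_tmul,
    inner_bra_bra, orthonormal_iff_ite.1 hα, orthonormal_iff_ite.1 hα]
  rcases eq_or_ne i j with rfl | hij
  · simp
  · simp [hij]

theorem inner_self_of_isCanonicalPurification {ρ : H →L[ℂ] H} (hρ : IsState ρ)
    {Ψ : HilbertTensorDual H} (hΨ : IsCanonicalPurification ρ Ψ) : inner ℂ Ψ Ψ = 1 := by
  obtain ⟨ι, l, α, hα, hl, hρl, hΨl⟩ := hΨ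
  obtain ⟨κ, b, hb⟩ := exists_hilbertBasis_hasSum_inner_apply_iff hα hρl
  have htrace : HasSum (fun i => (l i : ℂ)) 1 := (hb 1).1 (hρ.trace_eq_one κ b)
  refine (hasSum_inner_self_of_orthonormal (orthonormal_ketBra hα) hΨl).unique
    (htrace.congr_fun fun i => ?_)
  rw [Complex.conj_ofReal, ← Complex.ofReal_mul, Real.mul_self_sqrt (hl i)]

theorem qcf_zero {ρ : H →L[ℂ] H} (hρ : IsState ρ) {Ψ : HilbertTensorDual H}
    (hΨ : IsCanonicalPurification ρ Ψ) {n : ℕ} (A : Fin n → H →L[ℂ] H) (N : ℕ)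
    {w : Equiv.Perm (Fin n) → ℂ} (hw : ∑ σ, w σ = 1) : qcf A N w Ψ 0 = 1 := by
  have hone : unitaryOrdering A N w 0 = 1 := by
    simp [unitaryOrdering, NormedSpace.exp_zero, ← Finset.sum_smul, hw, List.ofFn_const]
  rw [qcf, hone, ampliation_one, inner_self_of_isCanonicalPurification hρ hΨ]

end PurificationNorm

section Order

variable {E : Type*} [NormedAddCommGroup E] [NormedSpace ℝ E]

theorem exists_seminorm_smulLeftCLM_le (k m : ℕ) (χ : 𝓢(E, ℂ)) :
    ∃ A : ℝ, 0 ≤ A ∧ ∀ φ : 𝓢(E, ℂ),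
      SchwartzMap.seminorm ℂ k m (SchwartzMap.smulLeftCLM ℂ χ φ) ≤
        A * (Finset.range (m + 1)).sup (SchwartzMap.seminorm ℂ 0) φ := by
  let A : ℝ := ∑ i ∈ Finset.range (m + 1), (m.choose i : ℝ) * SchwartzMap.seminorm ℂ k i χ
  have hA : 0 ≤ A := Finset.sum_nonneg fun i _ => by positivity
  refine ⟨A, hA, fun φ => SchwartzMap.seminorm_le_bound ℂ k m _
    (mul_nonneg hA (apply_nonneg _ _)) fun x => ?_⟩
  have hφ : ∀ i ∈ Finset.range (m + 1), ‖iteratedFDeriv ℝ (m - i) φ x‖ ≤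
      (Finset.range (m + 1)).sup (SchwartzMap.seminorm ℂ 0) φ := fun i _ =>
    (SchwartzMap.norm_iteratedFDeriv_le_seminorm ℂ φ (m - i) x).trans
      (Seminorm.le_finset_sup_apply (Finset.mem_range.2 (by omega)))
  calc ‖x‖ ^ k * ‖iteratedFDeriv ℝ m (SchwartzMap.smulLeftCLM ℂ χ φ) x‖
      = ‖x‖ ^ k * ‖iteratedFDeriv ℝ m (fun x => χ x * φ x) x‖ := by
        rw [funext (SchwartzMap.smulLeftCLM_apply_apply χ.hasTemperateGrowth φ)]
        rfl
    _ ≤ ‖x‖ ^ k * ∑ i ∈ Finset.range (m + 1), (m.choose i : ℝ) * ‖iteratedFDeriv ℝ i χ x‖ *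
          ‖iteratedFDeriv ℝ (m - i) φ x‖ := by
        gcongr
        exact norm_iteratedFDeriv_mul_le (χ.smooth m) (φ.smooth m) x le_rfl
    _ = ∑ i ∈ Finset.range (m + 1), (m.choose i : ℝ) * (‖x‖ ^ k * ‖iteratedFDeriv ℝ i χ x‖) *
          ‖iteratedFDeriv ℝ (m - i) φ x‖ := by
        rw [Finset.mul_sum]
        exact Finset.sum_congr rfl fun i _ => by ring
    _ ≤ A * (Finset.range (m + 1)).sup (SchwartzMap.seminorm ℂ 0) φ := by
        rw [Finset.sum_mul]
        gcongr with i hi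
        · exact SchwartzMap.le_seminorm ℂ k i χ x
        · exact hφ i hi

theorem exists_norm_apply_le_sup_seminorm (u : 𝓢'(E, ℂ)) {χ : 𝓢(E, ℂ)}
    (hχ : ∀ φ, u (SchwartzMap.smulLeftCLM ℂ χ φ) = u φ) :
    ∃ (C : ℝ) (M : ℕ), 0 ≤ C ∧ ∀ φ : 𝓢(E, ℂ),
      ‖u φ‖ ≤ C * (Finset.range (M + 1)).sup (SchwartzMap.seminorm ℂ 0) φ := by
  let q : Seminorm ℂ 𝓢(E, ℂ) := (normSeminorm ℂ ℂ).comp (u : 𝓢(E, ℂ) →ₗ[ℂ] ℂ)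
  have hq : Continuous q := continuous_norm.comp (map_continuous u)
  obtain ⟨s, C, -, hC⟩ := Seminorm.bound_of_continuous (schwartz_withSeminorms ℂ E ℂ) q hq
  choose A hA0 hA using fun p : ℕ × ℕ => exists_seminorm_smulLeftCLM_le p.1 p.2 χ
  have hsum : 0 ≤ ∑ p ∈ s, A p := Finset.sum_nonneg fun p _ => hA0 p
  refine ⟨C * ∑ p ∈ s, A p, s.sup Prod.snd, mul_nonneg C.2 hsum, fun φ => ?_⟩
  let P : Seminorm ℂ 𝓢(E, ℂ) :=
    (Finset.range (s.sup Prod.snd + 1)).sup (SchwartzMap.seminorm ℂ 0)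
  have hp : ∀ p ∈ s, schwartzSeminormFamily ℂ E ℂ p (SchwartzMap.smulLeftCLM ℂ χ φ) ≤
      (∑ p ∈ s, A p) * P φ := fun p hp =>
    calc schwartzSeminormFamily ℂ E ℂ p (SchwartzMap.smulLeftCLM ℂ χ φ)
        ≤ A p * (Finset.range (p.2 + 1)).sup (SchwartzMap.seminorm ℂ 0) φ := hA p φ
      _ ≤ (∑ p ∈ s, A p) * P φ := by
          gcongr
          · exact Finset.single_le_sum (fun p _ => hA0 p) hp
          · exact Seminorm.le_def.1 (Finset.sup_mono (Finset.range_subset_range.2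
              (Nat.add_le_add_right (Finset.le_sup (f := Prod.snd) hp) 1))) φ
  calc ‖u φ‖ = q (SchwartzMap.smulLeftCLM ℂ χ φ) := congrArg norm (hχ φ).symm
    _ ≤ C * s.sup (schwartzSeminormFamily ℂ E ℂ) (SchwartzMap.smulLeftCLM ℂ χ φ) := hC _
    _ ≤ C * ((∑ p ∈ s, A p) * P φ) := by
        gcongr
        exact Seminorm.finset_sup_apply_le (mul_nonneg hsum (apply_nonneg _ _)) hp
    _ = C * (∑ p ∈ s, A p) * P φ := (mul_assoc _ _ _).symm

end Order

section CharTransformSeminorm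

variable {n : ℕ}

/-- The pairing `-(θ · x) / 2π`, for which the Fourier integral of `VectorFourier` has the kernel
`e^{i θ·x}`. -/
def charPairing (n : ℕ) :
    EuclideanSpace ℝ (Fin n) →L[ℝ] EuclideanSpace ℝ (Fin n) →L[ℝ] ℝ :=
  (-(2 * Real.pi)⁻¹) • innerSL ℝ

theorem two_pi_mul_norm_charPairing_le (n : ℕ) : 2 * Real.pi * ‖charPairing n‖ ≤ 1 := by
  have hnorm : ‖charPairing n‖ ≤ (2 * Real.pi)⁻¹ := by
    refine ContinuousLinearMap.opNorm_le_bound₂ _ (by positivity) fun x y => ?_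
    change ‖-(2 * Real.pi)⁻¹ * inner ℝ x y‖ ≤ _
    rw [norm_mul, norm_neg, Real.norm_of_nonneg (by positivity), mul_assoc]
    gcongr
    exact norm_inner_le_norm x y
  calc 2 * Real.pi * ‖charPairing n‖ ≤ 2 * Real.pi * (2 * Real.pi)⁻¹ := by gcongr
    _ = 1 := by field_simp

theorem charTransform_eq_fourierIntegral (f : 𝓢(EuclideanSpace ℝ (Fin n), ℂ)) :
    ⇑(charTransform f) =
      VectorFourier.fourierIntegral 𝐞 volume (charPairing n).toLinearMap₁₂ f := by
  ext x
  rw [charTransform_apply, VectorFourier.fourierIntegral]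
  refine integral_congr_ae (Eventually.of_forall fun θ => ?_)
  have hθ : (charPairing n).toLinearMap₁₂ θ x = -(2 * Real.pi)⁻¹ * inner ℝ θ x := rfl
  have hπ : (Real.pi : ℂ) ≠ 0 := Complex.ofReal_ne_zero.2 Real.pi_ne_zero
  beta_reduce
  rw [Circle.smul_def, Real.fourierChar_apply, smul_eq_mul, hθ]
  congr 2
  push_cast
  field_simp

theorem seminorm_charTransform_le (m : ℕ) (f : 𝓢(EuclideanSpace ℝ (Fin n), ℂ)) :
    SchwartzMap.seminorm ℂ 0 m (charTransform f) ≤ ∫ θ, ‖θ‖ ^ m * ‖f θ‖ := by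
  have hf : ∀ k : ℕ, Integrable fun θ => ‖θ‖ ^ k * ‖f θ‖ := f.integrable_pow_mul volume
  refine SchwartzMap.seminorm_le_bound ℂ 0 m _ (by positivity) fun x => ?_
  rw [pow_zero, one_mul, charTransform_eq_fourierIntegral,
    VectorFourier.iteratedFDeriv_fourierIntegral (N := ⊤) _ (fun k _ => hf k)
      f.continuous.aestronglyMeasurable le_top]
  refine (VectorFourier.norm_fourierIntegral_le_integral_norm _ _ _ _ _).trans
    (integral_mono_of_nonneg (Eventually.of_forall fun θ => norm_nonneg _) (hf m)
      (Eventually.of_forall fun θ => ?_))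
  calc ‖VectorFourier.fourierPowSMulRight (charPairing n) f θ m‖
      ≤ (2 * Real.pi * ‖charPairing n‖) ^ m * ‖θ‖ ^ m * ‖f θ‖ :=
        VectorFourier.norm_fourierPowSMulRight_le _ f θ m
    _ ≤ ‖θ‖ ^ m * ‖f θ‖ := by
        rw [mul_assoc]
        exact mul_le_of_le_one_left (by positivity)
          (pow_le_one₀ (by positivity) (two_pi_mul_norm_charPairing_le n))

end CharTransformSeminorm

section JapaneseWeight

variable {E : Type*} [NormedAddCommGroup E]

/-- The weight `(1 + ‖θ‖²)^r` comparing growth at infinity; complex-valued so that it multiplies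
complex Schwartz functions. -/
def japaneseWeight (r : ℝ) (θ : E) : ℂ := (((1 + ‖θ‖ ^ 2) ^ r : ℝ) : ℂ)

theorem norm_japaneseWeight (r : ℝ) (θ : E) : ‖japaneseWeight r θ‖ = (1 + ‖θ‖ ^ 2) ^ r := by
  rw [japaneseWeight, Complex.norm_real, Real.norm_of_nonneg (by positivity)]

theorem japaneseWeight_add (r s : ℝ) (θ : E) :
    japaneseWeight (r + s) θ = japaneseWeight r θ * japaneseWeight s θ := by
  rw [japaneseWeight, Real.rpow_add (by positivity), Complex.ofReal_mul]
  rfl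

theorem japaneseWeight_zero (θ : E) : japaneseWeight 0 θ = 1 := by
  rw [japaneseWeight, Real.rpow_zero, Complex.ofReal_one]

-- Peetre's inequality.
theorem norm_japaneseWeight_le {r : ℝ} (hr : 0 ≤ r) (θ τ : E) :
    ‖japaneseWeight r θ‖ ≤ 2 ^ r * ‖japaneseWeight r τ‖ * ‖japaneseWeight r (θ - τ)‖ := by
  rw [norm_japaneseWeight, norm_japaneseWeight, norm_japaneseWeight,
    ← Real.mul_rpow (by positivity) (by positivity),
    ← Real.mul_rpow (by positivity) (by positivity)]
  refine Real.rpow_le_rpow (by positivity) ?_ hr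
  have hθ : ‖θ‖ ^ 2 ≤ (‖τ‖ + ‖θ - τ‖) ^ 2 := by
    gcongr
    exact norm_le_insert' _ _
  nlinarith [sq_nonneg (‖τ‖ - ‖θ - τ‖), sq_nonneg (‖τ‖ * ‖θ - τ‖)]

variable [InnerProductSpace ℝ E]

theorem hasTemperateGrowth_japaneseWeight (r : ℝ) :
    (japaneseWeight r : E → ℂ).HasTemperateGrowth :=
  Complex.ofRealCLM.hasTemperateGrowth.comp (Function.hasTemperateGrowth_one_add_norm_sq_rpow E r)

theorem continuous_japaneseWeight (r : ℝ) : Continuous (japaneseWeight r : E → ℂ) :=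
  (hasTemperateGrowth_japaneseWeight r).1.continuous

theorem smulLeftCLM_japaneseWeight_apply (r : ℝ) (f : 𝓢(E, ℂ)) (θ : E) :
    SchwartzMap.smulLeftCLM ℂ (japaneseWeight r) f θ = japaneseWeight r θ * f θ :=
  SchwartzMap.smulLeftCLM_apply_apply (hasTemperateGrowth_japaneseWeight r) f θ

end JapaneseWeight

section Density

variable {E : Type*} [NormedAddCommGroup E] [InnerProductSpace ℝ E] [FiniteDimensional ℝ E]
  [MeasurableSpace E] [BorelSpace E]

theorem memLp_two_japaneseWeight {r : ℝ} (hr : (Module.finrank ℝ E : ℝ) < 4 * r) :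
    MemLp (japaneseWeight (-r) : E → ℂ) 2 := by
  rw [memLp_two_iff_integrable_sq_norm (continuous_japaneseWeight _).aestronglyMeasurable]
  refine (integrable_rpow_neg_one_add_norm_sq hr).congr (Eventually.of_forall fun θ => ?_)
  beta_reduce
  rw [norm_japaneseWeight, ← Real.rpow_mul_natCast (by positivity)]
  congr 1
  push_cast
  ring

theorem integral_norm_japaneseWeight_mul_le {r : ℝ} (hr : (Module.finrank ℝ E : ℝ) < 4 * r)
    (s : ℝ) : ∃ A : ℝ, ∀ f : 𝓢(E, ℂ), ∫ θ, ‖japaneseWeight s θ * f θ‖ ≤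
      A * ‖(SchwartzMap.smulLeftCLM ℂ (japaneseWeight (r + s)) f).toLp 2 volume‖ := by
  refine ⟨(∫ θ : E, ‖japaneseWeight (-r) θ‖ ^ (2 : ℝ)) ^ (1 / (2 : ℝ)), fun f => ?_⟩
  set F := SchwartzMap.smulLeftCLM ℂ (japaneseWeight (r + s)) f with hF
  have htwo : ENNReal.ofReal 2 = 2 := by simp
  have hsplit : ∀ θ, ‖japaneseWeight s θ * f θ‖ = ‖japaneseWeight (-r) θ‖ * ‖F θ‖ := fun θ => by
    rw [hF, smulLeftCLM_japaneseWeight_apply, ← norm_mul, ← mul_assoc, ← japaneseWeight_add,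
      neg_add_cancel_left]
  have hnorm : ‖F.toLp 2 volume‖ = (∫ θ, ‖F θ‖ ^ (2 : ℝ)) ^ (1 / (2 : ℝ)) := by
    rw [SchwartzMap.norm_toLp' two_ne_zero ENNReal.ofNat_ne_top, ENNReal.toReal_ofNat,
      one_div]
  simp only [hsplit, hnorm]
  exact integral_mul_norm_le_Lp_mul_Lq Real.HolderConjugate.two_two
    (htwo.symm ▸ memLp_two_japaneseWeight hr) (htwo.symm ▸ F.memLp 2 volume)

theorem exists_density_of_norm_le_toLp (T : 𝓢(E, ℂ) →ₗ[ℂ] ℂ) {r A : ℝ}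
    (hT : ∀ f, ‖T f‖ ≤ A * ‖(SchwartzMap.smulLeftCLM ℂ (japaneseWeight r) f).toLp 2 volume‖) :
    ∃ g : E → ℂ, MemLp g 2 ∧ ∀ f, T f = ∫ θ, g θ * (japaneseWeight r θ * f θ) := by
  let W := SchwartzMap.smulLeftCLM ℂ (japaneseWeight (E := E) r)
  let V := SchwartzMap.smulLeftCLM ℂ (japaneseWeight (E := E) (-r))
  have hWV : ∀ f, W (V f) = f := fun f => by
    ext θ
    rw [smulLeftCLM_japaneseWeight_apply, smulLeftCLM_japaneseWeight_apply, ← mul_assoc,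
      ← japaneseWeight_add, add_neg_cancel, japaneseWeight_zero, one_mul]
  have hVW : ∀ f, V (W f) = f := fun f => by
    ext θ
    rw [smulLeftCLM_japaneseWeight_apply, smulLeftCLM_japaneseWeight_apply, ← mul_assoc,
      ← japaneseWeight_add, neg_add_cancel, japaneseWeight_zero, one_mul]
  let J : 𝓢(E, ℂ) →ₗ[ℂ] Lp ℂ 2 (volume : Measure E) :=
    (SchwartzMap.toLpCLM ℂ ℂ 2 volume).toLinearMap
  have hbound : ∀ f, ‖(T ∘ₗ (V : _ →ₗ[ℂ] _)) f‖ ≤ A * ‖J f‖ := fun f => by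
    have := hT (V f)
    rwa [show SchwartzMap.smulLeftCLM ℂ (japaneseWeight r) (V f) = f from hWV f] at this
  let l := (T ∘ₗ (V : _ →ₗ[ℂ] _)).extendOfNorm J
  have hl : ∀ f, l (J f) = T (V f) := LinearMap.extendOfNorm_eq
    (SchwartzMap.denseRange_toLpCLM ENNReal.ofNat_ne_top) ⟨A, hbound⟩
  let G := (InnerProductSpace.toDual ℂ (Lp ℂ 2 (volume : Measure E))).symm l
  refine ⟨fun θ => conj (G θ), (Lp.memLp G).star, fun f => ?_⟩
  rw [← hVW f, ← hl, ← InnerProductSpace.toDual_symm_apply, L2.inner_def, hVW]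
  refine integral_congr_ae ?_
  filter_upwards [SchwartzMap.coeFn_toLp (W f) 2 volume] with θ hθ
  rw [show (J (W f) : E → ℂ) θ = W f θ from hθ, smulLeftCLM_japaneseWeight_apply,
    RCLike.inner_apply]
  ring

theorem exists_integrable_density (T : 𝓢(E, ℂ) →ₗ[ℂ] ℂ) {C s : ℝ} (hC : 0 ≤ C) (hs : 0 ≤ s)
    (hT : ∀ f, ‖T f‖ ≤ C * ∫ θ, ‖japaneseWeight s θ * f θ‖) :
    ∃ (r : ℝ) (g : E → ℂ), 0 ≤ r ∧ Integrable g ∧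
      ∀ f, T f = ∫ θ, g θ * (japaneseWeight r θ * f θ) := by
  let d : ℝ := Module.finrank ℝ E + 1
  have hd : (Module.finrank ℝ E : ℝ) < 4 * d := by
    have : (0 : ℝ) ≤ Module.finrank ℝ E := by positivity
    linarith
  obtain ⟨A, hA⟩ := integral_norm_japaneseWeight_mul_le hd s
  obtain ⟨g, hg, hgT⟩ := exists_density_of_norm_le_toLp T (r := d + s) (A := C * A) fun f =>
    (hT f).trans ((mul_le_mul_of_nonneg_left (hA f) hC).trans_eq (mul_assoc _ _ _).symm)
  refine ⟨d + (d + s), fun θ => g θ * japaneseWeight (-d) θ, by positivity,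
    hg.integrable_mul (memLp_two_japaneseWeight hd), fun f => ?_⟩
  rw [hgT]
  congr 1 with θ
  rw [mul_assoc, ← mul_assoc (japaneseWeight (-d) θ), ← japaneseWeight_add, neg_add_cancel_left]

theorem integrable_mul_translate {g : E → ℂ} (hg : Integrable g) {r : ℝ} (hr : 0 ≤ r)
    (f η : 𝓢(E, ℂ)) : Integrable (fun p : E × E =>
      g p.1 * (japaneseWeight r p.1 * (f p.2 * η (p.1 - p.2)))) (volume.prod volume) := by
  let W := SchwartzMap.smulLeftCLM ℂ (japaneseWeight (E := E) r)
  have hmeas : AEStronglyMeasurable (fun p : E × E =>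
      g p.1 * (japaneseWeight r p.1 * (f p.2 * η (p.1 - p.2)))) (volume.prod volume) := by
    have hw := continuous_japaneseWeight (E := E) r
    exact hg.1.comp_fst.mul (by fun_prop : Continuous fun p : E × E =>
      japaneseWeight r p.1 * (f p.2 * η (p.1 - p.2))).aestronglyMeasurable
  refine ((hg.norm.mul_prod (W f).integrable.norm).const_mul
    (2 ^ r * SchwartzMap.seminorm ℂ 0 0 (W η))).mono' hmeas (Eventually.of_forall fun p => ?_)
  have hη : ‖japaneseWeight r (p.1 - p.2) * η (p.1 - p.2)‖ ≤ SchwartzMap.seminorm ℂ 0 0 (W η) := by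
    rw [← smulLeftCLM_japaneseWeight_apply]
    exact SchwartzMap.norm_le_seminorm ℂ (W η) _
  calc ‖g p.1 * (japaneseWeight r p.1 * (f p.2 * η (p.1 - p.2)))‖
      = ‖g p.1‖ * (‖japaneseWeight r p.1‖ * (‖f p.2‖ * ‖η (p.1 - p.2)‖)) := by
        simp only [norm_mul]
    _ ≤ ‖g p.1‖ * (2 ^ r * ‖japaneseWeight r p.2‖ * ‖japaneseWeight r (p.1 - p.2)‖ *
          (‖f p.2‖ * ‖η (p.1 - p.2)‖)) := by
        gcongr
        exact norm_japaneseWeight_le hr p.1 p.2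
    _ = 2 ^ r * ‖japaneseWeight r (p.1 - p.2) * η (p.1 - p.2)‖ * (‖g p.1‖ * ‖W f p.2‖) := by
        rw [smulLeftCLM_japaneseWeight_apply, norm_mul, norm_mul]
        ring
    _ ≤ 2 ^ r * SchwartzMap.seminorm ℂ 0 0 (W η) * (‖g p.1‖ * ‖W f p.2‖) := by gcongr

theorem apply_convolution_eq_integral {T : 𝓢(E, ℂ) →ₗ[ℂ] ℂ} {r : ℝ} {g : E → ℂ} (hr : 0 ≤ r)
    (hg : Integrable g) (hT : ∀ f, T f = ∫ θ, g θ * (japaneseWeight r θ * f θ)) (f η : 𝓢(E, ℂ)) :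
    T (SchwartzMap.convolution (ContinuousLinearMap.mul ℂ ℂ) f η) =
      ∫ τ, f τ * T (SchwartzMap.compSubConstCLM ℂ τ η) :=
  calc T (SchwartzMap.convolution (ContinuousLinearMap.mul ℂ ℂ) f η)
      = ∫ θ, ∫ τ, g θ * (japaneseWeight r θ * (f τ * η (θ - τ))) := by
        rw [hT]
        congr 1 with θ
        rw [SchwartzMap.convolution_apply, convolution_def, ← integral_const_mul,
          ← integral_const_mul]
        rfl
    _ = ∫ τ, ∫ θ, g θ * (japaneseWeight r θ * (f τ * η (θ - τ))) :=
        integral_integral_swap (integrable_mul_translate hg hr f η)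
    _ = ∫ τ, f τ * T (SchwartzMap.compSubConstCLM ℂ τ η) := by
        congr 1 with τ
        rw [hT, ← integral_const_mul]
        congr 1 with θ
        rw [SchwartzMap.compSubConstCLM_apply]
        ring

end Density

section Uniqueness

variable {n : ℕ}

theorem sup_seminorm_charTransform_le (M : ℕ) (f : 𝓢(EuclideanSpace ℝ (Fin n), ℂ)) :
    (Finset.range (M + 1)).sup (SchwartzMap.seminorm ℂ 0) (charTransform f) ≤
      ∫ θ, ‖japaneseWeight M θ * f θ‖ := by
  have hint : Integrable fun θ => japaneseWeight M θ * f θ :=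
    (SchwartzMap.smulLeftCLM ℂ (japaneseWeight M) f).integrable.congr
      (Eventually.of_forall (smulLeftCLM_japaneseWeight_apply M f))
  refine Seminorm.finset_sup_apply_le (by positivity) fun m hm =>
    (seminorm_charTransform_le m f).trans (integral_mono_of_nonneg
      (Eventually.of_forall fun θ => by positivity) hint.norm (Eventually.of_forall fun θ => ?_))
  have hone : 1 ≤ 1 + ‖θ‖ ^ 2 := le_add_of_nonneg_right (by positivity)
  calc ‖θ‖ ^ m * ‖f θ‖ ≤ (1 + ‖θ‖ ^ 2) ^ m * ‖f θ‖ := by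
        gcongr
        nlinarith [sq_nonneg (‖θ‖ - 1)]
    _ ≤ (1 + ‖θ‖ ^ 2) ^ M * ‖f θ‖ := by
        gcongr
        exact Nat.lt_succ_iff.1 (Finset.mem_range.1 hm)
    _ = ‖japaneseWeight M θ * f θ‖ := by
        rw [norm_mul, norm_japaneseWeight, Real.rpow_natCast]

theorem eq_zero_of_apply_exp_mul_eq_zero (v : 𝓢'(EuclideanSpace ℝ (Fin n), ℂ))
    {χ : 𝓢(EuclideanSpace ℝ (Fin n), ℂ)} (hχ : ∀ φ, v (SchwartzMap.smulLeftCLM ℂ χ φ) = v φ)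
    (hv : ∀ (τ : EuclideanSpace ℝ (Fin n)) (ψ : 𝓢(EuclideanSpace ℝ (Fin n), ℂ)),
      (∀ x, ψ x = Complex.exp (Complex.I * (inner ℝ τ x : ℝ)) * χ x) → v ψ = 0) : v = 0 := by
  obtain ⟨C, M, hC, hCM⟩ := exists_norm_apply_le_sup_seminorm v hχ
  let T : 𝓢(EuclideanSpace ℝ (Fin n), ℂ) →ₗ[ℂ] ℂ :=
    (v : 𝓢(EuclideanSpace ℝ (Fin n), ℂ) →ₗ[ℂ] ℂ) ∘ₗ (charTransformCLE n : _ →ₗ[ℂ] _)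
  have hT : ∀ f, T f = v (charTransform f) := fun f => rfl
  obtain ⟨r, g, hr, hg, hTg⟩ := exists_integrable_density T hC M.cast_nonneg fun f =>
    (hCM _).trans (mul_le_mul_of_nonneg_left (sup_seminorm_charTransform_le M f) hC)
  obtain ⟨η, rfl⟩ := (charTransformCLE n).surjective χ
  ext φ
  obtain ⟨f, rfl⟩ := (charTransformCLE n).surjective φ
  calc v (charTransform f)
      = T (SchwartzMap.convolution (ContinuousLinearMap.mul ℂ ℂ) f η) := by
        rw [hT, charTransform_convolution, ← hχ]
        congr 1
        ext x
        rw [charTransformCLE_apply,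
          SchwartzMap.smulLeftCLM_apply_apply (charTransform η).hasTemperateGrowth,
          SchwartzMap.smulLeftCLM_apply_apply (charTransform f).hasTemperateGrowth,
          smul_eq_mul, smul_eq_mul, mul_comm]
    _ = ∫ τ, f τ * T (SchwartzMap.compSubConstCLM ℂ τ η) :=
        apply_convolution_eq_integral hr hg hTg f η
    _ = 0 := integral_eq_zero_of_ae (Eventually.of_forall fun τ => by
        beta_reduce
        rw [hT, hv τ _ (charTransform_compSubConstCLM η τ), mul_zero]
        rfl)

theorem eq_of_hasIntegral_exp {u v : 𝓢'(EuclideanSpace ℝ (Fin n), ℂ)} (hu : IsCompactlySupported u)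
    (hv : IsCompactlySupported v) {C : EuclideanSpace ℝ (Fin n) → ℂ}
    (hCu : ∀ θ : EuclideanSpace ℝ (Fin n), HasIntegral u
      (fun x => Complex.exp (Complex.I * (inner ℝ θ x : ℝ))) (C θ))
    (hCv : ∀ θ : EuclideanSpace ℝ (Fin n), HasIntegral v
      (fun x => Complex.exp (Complex.I * (inner ℝ θ x : ℝ))) (C θ)) : u = v := by
  obtain ⟨χ, -, hχ⟩ := exists_schwartzMap_eq_near (hu.union hv) isOpen_univ (subset_univ _)
    (contDiffOn_const (c := (1 : ℂ)))
  rw [nhdsSet_union, eventually_sup] at hχ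
  have htrunc : ∀ w : 𝓢'(EuclideanSpace ℝ (Fin n), ℂ),
      (∀ᶠ x in 𝓝ˢ (Distribution.dsupport w), χ x = 1) →
      ∀ φ, w (SchwartzMap.smulLeftCLM ℂ χ φ) = w φ := fun w hw φ =>
    apply_congr_of_eventually_eq w (hw.mono fun x hx => by
      rw [SchwartzMap.smulLeftCLM_apply_apply χ.hasTemperateGrowth, hx, one_smul])
  refine sub_eq_zero.1 (eq_zero_of_apply_exp_mul_eq_zero (χ := χ) _ (fun φ => ?_) fun τ ψ hψ => ?_)
  · rw [sub_apply, sub_apply, htrunc u hχ.1, htrunc v hχ.2]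
  · rw [sub_apply, (hCu τ).2 ψ (hχ.1.mono fun x hx => by rw [hψ, hx, mul_one]),
      (hCv τ).2 ψ (hχ.2.mono fun x hx => by rw [hψ, hx, mul_one]), sub_self]

end Uniqueness

section Reality

/-- The complex conjugate of a Schwartz function. -/
def conjSchwartz {E : Type*} [NormedAddCommGroup E] [NormedSpace ℝ E] (φ : 𝓢(E, ℂ)) : 𝓢(E, ℂ) :=
  SchwartzMap.postcompCLM (Complex.conjCLE : ℂ →L[ℝ] ℂ) φ

theorem conjSchwartz_apply {E : Type*} [NormedAddCommGroup E] [NormedSpace ℝ E] (φ : 𝓢(E, ℂ))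
    (x : E) : conjSchwartz φ x = conj (φ x) := rfl

variable {n : ℕ} {u : 𝓢'(EuclideanSpace ℝ (Fin n), ℂ)} {C : EuclideanSpace ℝ (Fin n) → ℂ}

theorem isRealDistribution_iff_apply_conjSchwartz :
    IsRealDistribution u ↔ ∀ φ, u (conjSchwartz φ) = conj (u φ) := by
  constructor
  · intro h φ
    have hre := h (φ + conjSchwartz φ) fun x => by
      rw [add_apply, conjSchwartz_apply, Complex.add_conj, Complex.ofReal_im]
    have him := h (Complex.I • (φ - conjSchwartz φ)) fun x => by
      rw [smul_apply, sub_apply, conjSchwartz_apply, Complex.sub_conj]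
      simp
    rw [map_add, Complex.add_im] at hre
    rw [map_smul, map_sub, smul_eq_mul, Complex.I_mul_im, Complex.sub_re] at him
    exact Complex.ext (sub_eq_zero.1 him).symm (eq_neg_of_add_eq_zero_right hre)
  · intro h φ hφ
    have hφconj : conjSchwartz φ = φ := by
      ext x
      rw [conjSchwartz_apply, Complex.conj_eq_iff_im.2 (hφ x)]
    exact Complex.conj_eq_iff_im.1 ((h φ).symm.trans (congrArg u hφconj))

theorem conj_exp_I_mul_ofReal (t : ℝ) :
    conj (Complex.exp (Complex.I * t)) = Complex.exp (Complex.I * (-t : ℝ)) := by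
  rw [← Complex.exp_conj, map_mul, Complex.conj_I, Complex.conj_ofReal, Complex.ofReal_neg,
    neg_mul, mul_neg]

theorem conjSchwartz_charTransform (f : 𝓢(EuclideanSpace ℝ (Fin n), ℂ)) :
    conjSchwartz (charTransform f) = charTransform (SchwartzMap.compCLMOfContinuousLinearEquiv ℂ
      (ContinuousLinearEquiv.neg ℝ) (conjSchwartz f)) := by
  ext x
  rw [conjSchwartz_apply, charTransform_apply, charTransform_apply, ← integral_conj,
    ← integral_neg_eq_self]
  congr 1
  ext θ
  rw [map_mul, conj_exp_I_mul_ofReal, inner_neg_left, neg_neg]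
  rfl

theorem isRealDistribution_iff (hu : IsFourierTransform u C) (hexp : ∀ θ : EuclideanSpace ℝ (Fin n),
    HasIntegral u (fun x => Complex.exp (Complex.I * (inner ℝ θ x : ℝ))) (C θ)) :
    IsRealDistribution u ↔ ∀ θ, C (-θ) = conj (C θ) := by
  rw [isRealDistribution_iff_apply_conjSchwartz]
  constructor
  · intro h θ
    obtain ⟨ψ, hψ⟩ := (hexp θ).1
    rw [← (hexp θ).2 ψ hψ, ← h ψ]
    refine ((hexp (-θ)).2 _ (hψ.mono fun x hx => ?_)).symm
    beta_reduce
    rw [conjSchwartz_apply, hx, conj_exp_I_mul_ofReal, inner_neg_left]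
  · intro h φ
    rw [← charTransform_symm_apply φ, conjSchwartz_charTransform, ← hu, ← hu, ← integral_conj,
      ← integral_neg_eq_self]
    congr 1
    ext θ
    rw [h, map_mul]
    congr 1
    change conj (((charTransformCLE n).symm φ) (- -θ)) = _
    rw [neg_neg]

end Reality

section FiniteDimension

variable {H : Type*} [NormedAddCommGroup H] [InnerProductSpace ℂ H] [CompleteSpace H]

theorem exp_apply_of_apply_eq_smul {X : H →L[ℂ] H} {c : ℂ} {v : H} (h : X v = c • v) :
    NormedSpace.exp X v = Complex.exp c • v := by
  let _ := NormedAlgebra.restrictScalars ℚ ℂ (H →L[ℂ] H)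
  have hpow : ∀ k : ℕ, (X ^ k) v = c ^ k • v := fun k => by
    induction k with
    | zero => simp
    | succ k ih => rw [pow_succ, mul_apply_eq_comp, h, map_smul, ih, smul_smul, pow_succ, mul_comm]
  rw [Complex.exp_eq_exp_ℂ]
  refine ((NormedSpace.exp_series_hasSum_exp' (𝕂 := ℂ) X).mapL
    (ContinuousLinearMap.apply ℂ H v)).unique
    (((NormedSpace.exp_series_hasSum_exp' (𝕂 := ℂ) c).smul_const v).congr_fun fun k => ?_)
  rw [ContinuousLinearMap.apply_apply, smul_apply, hpow, smul_assoc]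

variable [FiniteDimensional ℂ H]

theorem exists_exp_smul_eq_sum {X : H →L[ℂ] H} (hX : IsSelfAdjoint X) :
    ∃ (a : Fin (Module.finrank ℂ H) → ℝ) (P : Fin (Module.finrank ℂ H) → H →L[ℂ] H),
      ∀ z : ℂ, NormedSpace.exp (z • X) = ∑ k, Complex.exp (z * a k) • P k := by
  have hsym : (X : H →ₗ[ℂ] H).IsSymmetric := hX.isSymmetric
  let b := hsym.eigenvectorBasis rfl
  refine ⟨hsym.eigenvalues rfl, fun k => (innerSL ℂ (b k)).smulRight (b k), fun z => ?_⟩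
  ext v
  conv_lhs => rw [← b.sum_repr' v]
  rw [map_sum, sum_apply]
  refine Finset.sum_congr rfl fun k _ => ?_
  have heigen : (z • X) (b k) = (z * hsym.eigenvalues rfl k) • b k := by
    rw [smul_apply, mul_smul]
    exact congrArg (z • ·) (hsym.apply_eigenvectorBasis rfl k)
  rw [map_smul, exp_apply_of_apply_eq_smul heigen, smul_apply,
    ContinuousLinearMap.smulRight_apply, innerSL_apply_apply, smul_comm]

theorem exists_multilinear_exp_eq_sum {ι : Type} [Finite ι] {E : Type*} [NormedAddCommGroup E]
    [InnerProductSpace ℝ E] (Φ : ContinuousMultilinearMap ℂ (fun _ : ι => H →L[ℂ] H) ℂ)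
    {a : ι → H →L[ℂ] H} (ha : ∀ i, IsSelfAdjoint (a i)) (v : ι → E) :
    ∃ (S : Type) (_ : Fintype S) (c : S → ℂ) (x : S → E), ∀ θ,
      Φ (fun i => NormedSpace.exp ((Complex.I * (inner ℝ (v i) θ : ℝ)) • a i)) =
        ∑ s, c s * Complex.exp (Complex.I * (inner ℝ θ (x s) : ℝ)) := by
  classical
  cases nonempty_fintype ι
  choose e P heP using fun i => exists_exp_smul_eq_sum (ha i)
  refine ⟨ι → Fin (Module.finrank ℂ H), inferInstance, fun s => Φ fun i => P i (s i),
    fun s => ∑ i, e i (s i) • v i, fun θ => ?_⟩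
  simp only [heP]
  rw [ContinuousMultilinearMap.map_sum]
  refine Finset.sum_congr rfl fun s _ => ?_
  rw [ContinuousMultilinearMap.map_smul_univ, smul_eq_mul, mul_comm, ← Complex.exp_sum, inner_sum,
    Complex.ofReal_sum, Finset.mul_sum]
  congr 2
  refine Finset.sum_congr rfl fun i _ => ?_
  rw [inner_smul_right, real_inner_comm, Complex.ofReal_mul, mul_assoc, mul_comm (e i (s i) : ℂ)]

theorem exists_qcf_eq_sum {n : ℕ} {A : Fin n → H →L[ℂ] H} (hA : ∀ j, IsSelfAdjoint (A j)) (N : ℕ)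
    (w : Equiv.Perm (Fin n) → ℂ) (Ψ : HilbertTensorDual H) :
    ∃ (S : Type) (_ : Fintype S) (c : S → ℂ) (x : S → EuclideanSpace ℝ (Fin n)), ∀ θ,
      qcf A N w Ψ θ = ∑ s, c s * Complex.exp (Complex.I * (inner ℝ θ (x s) : ℝ)) := by
  simp only [qcf_eq_polarizedOrdering_exp]
  exact exists_multilinear_exp_eq_sum
    ((purificationExpectation Ψ).compContinuousMultilinearMap (polarizedOrdering (H →L[ℂ] H) N w))
    (fun p : (Σ _ : Fin N, Fin n) => hA p.2)
    fun p => (N : ℝ)⁻¹ • EuclideanSpace.single p.2 (1 : ℝ)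

end FiniteDimension

section SignedMeasure

variable {n : ℕ} {u : 𝓢'(EuclideanSpace ℝ (Fin n), ℂ)} {C : EuclideanSpace ℝ (Fin n) → ℂ}

theorem apply_eq_sum_of_isFourierTransform {S : Type*} [Fintype S] (hu : IsFourierTransform u C)
    {c : S → ℂ} {x : S → EuclideanSpace ℝ (Fin n)}
    (hC : ∀ θ, C θ = ∑ s, c s * Complex.exp (Complex.I * (inner ℝ θ (x s) : ℝ)))
    (φ : 𝓢(EuclideanSpace ℝ (Fin n), ℂ)) : u φ = ∑ s, c s * φ (x s) := by
  obtain ⟨f, rfl⟩ := (charTransformCLE n).surjective φ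
  have hint : ∀ y : EuclideanSpace ℝ (Fin n), Integrable fun θ : EuclideanSpace ℝ (Fin n) =>
      Complex.exp (Complex.I * (inner ℝ θ y : ℝ)) * f θ := fun y => by
    simpa only [jointExp_pointFamily, smul_eq_mul, mul_comm] using
      (generatesBoundedGroup_pointFamily y).integrable_smul f
  rw [charTransformCLE_apply, ← hu]
  simp only [hC, Finset.sum_mul, mul_assoc]
  rw [integral_finsetSum _ fun s _ => (hint (x s)).const_mul _]
  simp only [integral_const_mul, charTransform_apply]

theorem IsSignedMeasureDistribution.isRealDistribution (h : IsSignedMeasureDistribution u) :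
    IsRealDistribution u := by
  obtain ⟨s, hs⟩ := h
  intro φ hφ
  have hre : ∀ x, φ x = ((φ x).re : ℂ) := fun x => Complex.ext rfl (hφ x)
  rw [hs, integral_congr_ae (Eventually.of_forall hre),
    integral_congr_ae (Eventually.of_forall hre), integral_complex_ofReal,
    integral_complex_ofReal, ← Complex.ofReal_sub, Complex.ofReal_im]

theorem integrable_schwartz_of_isFiniteMeasure {E F : Type*} [NormedAddCommGroup E]
    [NormedSpace ℝ E] [SecondCountableTopology E] [MeasurableSpace E] [OpensMeasurableSpace E]
    [NormedAddCommGroup F] [NormedSpace ℝ F] (μ : Measure E) [IsFiniteMeasure μ] (φ : 𝓢(E, F)) :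
    Integrable φ μ :=
  Integrable.of_bound φ.continuous.aestronglyMeasurable (SchwartzMap.seminorm ℝ 0 0 φ)
    (Eventually.of_forall fun x => SchwartzMap.norm_le_seminorm ℝ φ x)

theorem isSignedMeasureDistribution_of_eq_integral_sub (μ ν : Measure (EuclideanSpace ℝ (Fin n)))
    [IsFiniteMeasure μ] [IsFiniteMeasure ν] (h : ∀ φ, u φ = ∫ x, φ x ∂μ - ∫ x, φ x ∂ν) :
    IsSignedMeasureDistribution u := by
  refine ⟨μ.toSignedMeasure - ν.toSignedMeasure, fun φ => ?_⟩
  set s := μ.toSignedMeasure - ν.toSignedMeasure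
  set p := s.toJordanDecomposition.posPart
  set q := s.toJordanDecomposition.negPart
  have hjordan : p.toSignedMeasure - q.toSignedMeasure = μ.toSignedMeasure - ν.toSignedMeasure :=
    s.toSignedMeasure_toJordanDecomposition
  have hadd : μ + q = ν + p := by
    rw [← Measure.toSignedMeasure_eq_toSignedMeasure_iff, Measure.toSignedMeasure_add,
      Measure.toSignedMeasure_add]
    rw [sub_eq_sub_iff_add_eq_add] at hjordan
    rw [← hjordan, add_comm]
  have hint := fun (m : Measure (EuclideanSpace ℝ (Fin n))) [IsFiniteMeasure m] =>
    integrable_schwartz_of_isFiniteMeasure m φ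
  have hintegral : ∫ x, φ x ∂μ + ∫ x, φ x ∂q = ∫ x, φ x ∂ν + ∫ x, φ x ∂p := by
    rw [← integral_add_measure (hint μ) (hint q), hadd, integral_add_measure (hint ν) (hint p)]
  rw [h, sub_eq_sub_iff_add_eq_add, hintegral, add_comm]

theorem integral_sum_smul_dirac {S : Type*} [Fintype S] {a : S → ℝ} (ha : ∀ s, 0 ≤ a s)
    (x : S → EuclideanSpace ℝ (Fin n)) (φ : 𝓢(EuclideanSpace ℝ (Fin n), ℂ)) :
    ∫ y, φ y ∂(∑ s, ENNReal.ofReal (a s) • Measure.dirac (x s)) = ∑ s, (a s : ℂ) * φ (x s) := by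
  rw [integral_finsetSum_measure fun s _ =>
    (integrable_schwartz_of_isFiniteMeasure _ φ).smul_measure ENNReal.ofReal_ne_top]
  refine Finset.sum_congr rfl fun s _ => ?_
  rw [integral_smul_measure, integral_dirac, ENNReal.toReal_ofReal (ha s), Complex.real_smul]

theorem isSignedMeasureDistribution_of_eq_sum_ofReal {S : Type*} [Fintype S] {a : S → ℝ}
    {x : S → EuclideanSpace ℝ (Fin n)} (h : ∀ φ, u φ = ∑ s, (a s : ℂ) * φ (x s)) :
    IsSignedMeasureDistribution u := by
  have hfin : ∀ b : S → ℝ, IsFiniteMeasure (∑ s, ENNReal.ofReal (b s) • Measure.dirac (x s)) :=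
    fun b => ⟨by simp [Measure.finsetSum_apply, ENNReal.sum_lt_top]⟩
  have := hfin fun s => max (a s) 0
  have := hfin fun s => max (-a s) 0
  refine isSignedMeasureDistribution_of_eq_integral_sub
    (∑ s, ENNReal.ofReal (max (a s) 0) • Measure.dirac (x s))
    (∑ s, ENNReal.ofReal (max (-a s) 0) • Measure.dirac (x s)) fun φ => ?_
  rw [integral_sum_smul_dirac (fun s => le_max_right _ _),
    integral_sum_smul_dirac (fun s => le_max_right _ _), h, ← Finset.sum_sub_distrib]
  refine Finset.sum_congr rfl fun s _ => ?_
  rw [← sub_mul, ← Complex.ofReal_sub, max_zero_sub_max_neg_zero_eq_self]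

theorem IsRealDistribution.eq_sum_re {S : Type*} [Fintype S] (hu : IsRealDistribution u)
    {c : S → ℂ} {x : S → EuclideanSpace ℝ (Fin n)} (h : ∀ φ, u φ = ∑ s, c s * φ (x s))
    (φ : 𝓢(EuclideanSpace ℝ (Fin n), ℂ)) : u φ = ∑ s, ((c s).re : ℂ) * φ (x s) := by
  have hconj : u φ = ∑ s, conj (c s) * φ (x s) := by
    rw [← Complex.conj_conj (u φ), ← isRealDistribution_iff_apply_conjSchwartz.1 hu, h, map_sum]
    simp only [map_mul, conjSchwartz_apply, Complex.conj_conj]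
  calc u φ = (u φ + u φ) / 2 := (add_self_div_two _).symm
    _ = ∑ s, (c s + conj (c s)) * φ (x s) / 2 := by
        nth_rewrite 1 [h φ]
        rw [hconj, ← Finset.sum_add_distrib, Finset.sum_div]
        simp only [add_mul]
    _ = ∑ s, ((c s).re : ℂ) * φ (x s) := Finset.sum_congr rfl fun s _ => by
        rw [Complex.add_conj, Complex.ofReal_mul, Complex.ofReal_ofNat]
        ring

theorem isRealDistribution_iff_isSignedMeasureDistribution {S : Type*} [Fintype S]
    (hu : IsFourierTransform u C) {c : S → ℂ} {x : S → EuclideanSpace ℝ (Fin n)}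
    (hC : ∀ θ, C θ = ∑ s, c s * Complex.exp (Complex.I * (inner ℝ θ (x s) : ℝ))) :
    IsRealDistribution u ↔ IsSignedMeasureDistribution u :=
  ⟨fun h => isSignedMeasureDistribution_of_eq_sum_ofReal
    (h.eq_sum_re (apply_eq_sum_of_isFourierTransform hu hC)), fun h => h.isRealDistribution⟩

end SignedMeasure

section Riesz

theorem exists_nonneg_extension {V W : Type*} [AddCommGroup V] [Module ℝ V] [AddCommGroup W]
    [PartialOrder W] [IsOrderedAddMonoid W] [Module ℝ W] [PosSMulMono ℝ W] (J : V →ₗ[ℝ] W)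
    (F : V →ₗ[ℝ] ℝ) (hF : ∀ v, 0 ≤ J v → 0 ≤ F v) (hJ : ∀ w, ∃ v, 0 ≤ J v + w) :
    ∃ G : W →ₗ[ℝ] ℝ, (∀ w, 0 ≤ w → 0 ≤ G w) ∧ ∀ v, G (J v) = F v := by
  have hker : F ∈ (LinearMap.ker J).dualAnnihilator := by
    refine (Submodule.mem_dualAnnihilator F).2 fun v hv => le_antisymm ?_ (hF v (le_of_eq hv.symm))
    have hneg : J (-v) = 0 := by rw [map_neg, LinearMap.mem_ker.1 hv, neg_zero]
    simpa using hF (-v) hneg.ge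
  rw [← LinearMap.range_dualMap_eq_dualAnnihilator_ker] at hker
  obtain ⟨F₀, rfl⟩ := hker
  obtain ⟨G, hGF, hG⟩ := riesz_extension (PointedCone.positive ℝ W)
    ⟨LinearMap.range J, F₀.domRestrict (LinearMap.range J)⟩
    (by rintro ⟨_, v, rfl⟩ hv; exact hF v hv)
    fun w => (hJ w).imp' (fun v => ⟨J v, v, rfl⟩) fun v hv => hv
  exact ⟨G, hG, fun v => hGF ⟨J v, v, rfl⟩⟩

theorem exists_isFiniteMeasure_of_nonneg {V X : Type*} [AddCommGroup V] [Module ℝ V]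
    [TopologicalSpace X] [CompactSpace X] [T2Space X] [MeasurableSpace X] [BorelSpace X]
    (J : V →ₗ[ℝ] C(X, ℝ)) (F : V →ₗ[ℝ] ℝ) (hF : ∀ v, 0 ≤ J v → 0 ≤ F v) {e : V} (he : J e = 1) :
    ∃ μ : Measure X, IsFiniteMeasure μ ∧ ∀ v, ∫ x, J v x ∂μ = F v := by
  obtain ⟨G, hG, hGJ⟩ := exists_nonneg_extension J F hF fun g => ⟨‖g‖ • e, fun x => by
    rw [map_smul, he]
    simpa using neg_le_iff_add_nonneg'.1 ((abs_le.1 (g.norm_coe_le_norm x)).1)⟩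
  let Λ : CompactlySupportedContinuousMap X ℝ →ₚ[ℝ] ℝ := PositiveLinearMap.mk₀
    { toFun := fun g => G g.toContinuousMap
      map_add' := fun g h => map_add G g.toContinuousMap h.toContinuousMap
      map_smul' := fun c g => map_smul G c g.toContinuousMap }
    fun g hg => hG g.toContinuousMap hg
  exact ⟨RealRMK.rieszMeasure Λ, inferInstance, fun v => (RealRMK.integral_rieszMeasure Λ
    (CompactlySupportedContinuousMap.continuousMapEquiv (J v))).trans (hGJ v)⟩

end Riesz

section PositiveFunctional

open scoped ComplexOrder

/-- A real-valued Schwartz function as a complex-valued one. -/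
def ofRealSchwartz {E : Type*} [NormedAddCommGroup E] [NormedSpace ℝ E] :
    𝓢(E, ℝ) →L[ℝ] 𝓢(E, ℂ) :=
  SchwartzMap.postcompCLM Complex.ofRealCLM

theorem ofRealSchwartz_apply {E : Type*} [NormedAddCommGroup E] [NormedSpace ℝ E] (φ : 𝓢(E, ℝ))
    (x : E) : ofRealSchwartz φ x = φ x := rfl

/-- The Schwartz function `|ψ|²`. -/
def normSqSchwartz {E : Type*} [NormedAddCommGroup E] [NormedSpace ℝ E] (ψ : 𝓢(E, ℂ)) : 𝓢(E, ℂ) :=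
  SchwartzMap.smulLeftCLM ℂ ψ (conjSchwartz ψ)

theorem normSqSchwartz_apply {E : Type*} [NormedAddCommGroup E] [NormedSpace ℝ E] (ψ : 𝓢(E, ℂ))
    (x : E) : normSqSchwartz ψ x = ψ x * conj (ψ x) :=
  SchwartzMap.smulLeftCLM_apply_apply ψ.hasTemperateGrowth _ x

variable {E : Type*} [NormedAddCommGroup E] [NormedSpace ℝ E] [FiniteDimensional ℝ E] {K : Set E}

theorem exists_normSqSchwartz_eq_add_near (hK : IsCompact K) {φ : 𝓢(E, ℝ)}
    (hφ : ∀ x ∈ K, 0 ≤ φ x) {ε : ℝ} (hε : 0 < ε) :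
    ∃ ψ : 𝓢(E, ℂ), ∀ᶠ x in 𝓝ˢ K, normSqSchwartz ψ x = φ x + ε := by
  set U : Set E := {x | 0 < φ x + ε}
  have hU : IsOpen U := isOpen_lt continuous_const (φ.continuous.add continuous_const)
  have hKU : K ⊆ U := fun x hx => add_pos_of_nonneg_of_pos (hφ x hx) hε
  have hsqrt : ContDiffOn ℝ ∞ (fun x => (Real.sqrt (φ x + ε) : ℂ)) U :=
    Complex.ofRealCLM.contDiff.comp_contDiffOn
      (((φ.smooth ⊤).add contDiff_const).contDiffOn.sqrt fun x hx => ne_of_gt hx)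
  obtain ⟨ψ, -, hψ⟩ := exists_schwartzMap_eq_near hK hU hKU hsqrt
  refine ⟨ψ, ?_⟩
  filter_upwards [hψ, hU.mem_nhdsSet.2 hKU] with x hx (hxU : 0 < φ x + ε)
  rw [normSqSchwartz_apply, hx, Complex.conj_ofReal, ← Complex.ofReal_mul,
    Real.mul_self_sqrt hxU.le, Complex.ofReal_add]

theorem apply_ofRealSchwartz_nonneg {u : 𝓢'(E, ℂ)} (hK : IsCompact K)
    (hu : Distribution.dsupport u ⊆ K) (hsq : ∀ ψ, 0 ≤ u (normSqSchwartz ψ)) {φ : 𝓢(E, ℝ)}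
    (hφ : ∀ x ∈ K, 0 ≤ φ x) : 0 ≤ u (ofRealSchwartz φ) := by
  obtain ⟨χ, -, hχ⟩ := exists_schwartzMap_eq_near hK isOpen_univ (subset_univ K)
    (contDiffOn_const (c := (1 : ℂ)))
  have hε : ∀ ε : ℝ, 0 < ε → 0 ≤ u (ofRealSchwartz φ) + ε * u χ := fun ε hε => by
    obtain ⟨ψ, hψ⟩ := exists_normSqSchwartz_eq_add_near hK hφ hε
    have heq : u (normSqSchwartz ψ) = u (ofRealSchwartz φ + (ε : ℂ) • χ) :=
      apply_congr_of_eventually_eq u (((hψ.and hχ).filter_mono (nhdsSet_mono hu)).mono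
        fun x hx => by
          rw [hx.1, add_apply, smul_apply, ofRealSchwartz_apply, hx.2, smul_eq_mul, mul_one])
    simpa only [heq, map_add, map_smul, smul_eq_mul] using hsq ψ
  have hlim : Tendsto (fun ε : ℝ => u (ofRealSchwartz φ) + ε * u χ) (𝓝[>] 0)
      (𝓝 (u (ofRealSchwartz φ))) :=
    tendsto_nhdsWithin_of_tendsto_nhds (Continuous.tendsto' (by fun_prop) _ _ (by simp))
  exact ge_of_tendsto hlim (eventually_mem_nhdsWithin.mono hε)

theorem eq_ofRealSchwartz_add_I_smul {E : Type*} [NormedAddCommGroup E] [NormedSpace ℝ E]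
    (φ : 𝓢(E, ℂ)) : φ = ofRealSchwartz (SchwartzMap.postcompCLM Complex.reCLM φ) +
      Complex.I • ofRealSchwartz (SchwartzMap.postcompCLM Complex.imCLM φ) := by
  ext x
  rw [add_apply, smul_apply, smul_eq_mul, mul_comm]
  exact (Complex.re_add_im (φ x)).symm

theorem im_apply_ofRealSchwartz_eq_zero (hK : IsCompact K) (u : 𝓢(E, ℂ) →ₗ[ℂ] ℂ)
    (hu : ∀ φ : 𝓢(E, ℝ), (∀ x ∈ K, 0 ≤ φ x) → 0 ≤ u (ofRealSchwartz φ)) (φ : 𝓢(E, ℝ)) :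
    (u (ofRealSchwartz φ)).im = 0 := by
  obtain ⟨e, -, he⟩ := exists_schwartzMap_eq_near hK isOpen_univ (subset_univ K)
    (contDiffOn_const (c := (1 : ℝ)))
  set M := SchwartzMap.seminorm ℝ 0 0 φ
  have hM : ∀ x ∈ K, (M • e) x = M := fun x hx => by
    rw [smul_apply, (eventually_nhdsSet_iff_forall.1 he x hx).self_of_nhds, smul_eq_mul, mul_one]
  have hbound : ∀ x, |φ x| ≤ M := SchwartzMap.norm_le_seminorm ℝ φ
  have hMe := hu (M • e) fun x hx => (hM x hx).symm ▸ (abs_nonneg _).trans (hbound x)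
  have hφMe := hu (φ + M • e) fun x hx => by
    rw [add_apply, hM x hx]
    exact neg_le_iff_add_nonneg.1 (abs_le.1 (hbound x)).1
  have hsum := (Complex.nonneg_iff.1 hφMe).2
  rwa [map_add, map_add, Complex.add_im, ← (Complex.nonneg_iff.1 hMe).2, add_zero, eq_comm] at hsum

variable [MeasurableSpace E] [BorelSpace E]

theorem exists_isFiniteMeasure_of_apply_ofRealSchwartz_nonneg (hK : IsCompact K)
    (u : 𝓢(E, ℂ) →ₗ[ℂ] ℂ)
    (hu : ∀ φ : 𝓢(E, ℝ), (∀ x ∈ K, 0 ≤ φ x) → 0 ≤ u (ofRealSchwartz φ)) :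
    ∃ μ : Measure E, IsFiniteMeasure μ ∧ (∀ᵐ x ∂μ, x ∈ K) ∧ ∀ φ, u φ = ∫ x, φ x ∂μ := by
  have := isCompact_iff_compactSpace.1 hK
  let J : 𝓢(E, ℝ) →ₗ[ℝ] C(K, ℝ) :=
    { toFun := fun φ => ⟨fun x => φ x, φ.continuous.comp continuous_subtype_val⟩
      map_add' := fun _ _ => rfl
      map_smul' := fun _ _ => rfl }
  let F : 𝓢(E, ℝ) →ₗ[ℝ] ℝ :=
    Complex.reLm ∘ₗ u.restrictScalars ℝ ∘ₗ (ofRealSchwartz (E := E)).toLinearMap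
  obtain ⟨e, -, he⟩ := exists_schwartzMap_eq_near hK isOpen_univ (subset_univ K)
    (contDiffOn_const (c := (1 : ℝ)))
  obtain ⟨μ, hμ, hμF⟩ := exists_isFiniteMeasure_of_nonneg J F
    (fun φ hφ => (Complex.nonneg_iff.1 (hu φ fun x hx => hφ ⟨x, hx⟩)).1) (e := e)
    (ContinuousMap.ext fun x => (eventually_nhdsSet_iff_forall.1 he x x.2).self_of_nhds)
  have hemb := MeasurableEmbedding.subtype_coe hK.measurableSet
  have hreal : ∀ φ : 𝓢(E, ℝ), u (ofRealSchwartz φ) =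
      ((∫ x, φ x ∂(μ.map Subtype.val) : ℝ) : ℂ) := fun φ => by
    rw [hemb.integral_map]
    exact Complex.ext (hμF φ).symm (im_apply_ofRealSchwartz_eq_zero hK u hu φ)
  refine ⟨μ.map Subtype.val, inferInstance,
    hemb.ae_map_iff.2 (Eventually.of_forall Subtype.property), fun φ => ?_⟩
  have hint := integrable_schwartz_of_isFiniteMeasure (μ.map Subtype.val) φ
  conv_lhs => rw [eq_ofRealSchwartz_add_I_smul φ]
  rw [map_add, map_smul, hreal, hreal, smul_eq_mul, mul_comm, ← integral_re_add_im hint]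
  rfl

end PositiveFunctional

section BochnerCondition

open scoped ComplexOrder

theorem isPositiveDefiniteFunction_iff {n : ℕ} {C : EuclideanSpace ℝ (Fin n) → ℂ} :
    IsPositiveDefiniteFunction C ↔ ∀ (m : ℕ) (t : Fin m → EuclideanSpace ℝ (Fin n))
      (c : Fin m → ℂ), 0 ≤ ∑ j, ∑ k, c j * conj (c k) * C (t j - t k) := by
  simp only [IsPositiveDefiniteFunction, Complex.nonneg_iff, eq_comm]

variable {n : ℕ} {u : 𝓢'(EuclideanSpace ℝ (Fin n), ℂ)}

theorem isProbabilityDistribution_iff (hu : IsCompactlySupported u)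
    (hone : HasIntegral u (fun _ => 1) 1) :
    IsProbabilityDistribution u ↔ ∀ ψ, 0 ≤ u (normSqSchwartz ψ) := by
  constructor
  · rintro ⟨μ, -, hμ⟩ ψ
    rw [hμ]
    exact integral_nonneg fun x => by
      rw [normSqSchwartz_apply]
      exact mul_star_self_nonneg (ψ x)
  · intro hsq
    obtain ⟨μ, _, hμK, hμ⟩ := exists_isFiniteMeasure_of_apply_ofRealSchwartz_nonneg hu
      u.toLinearMap fun φ hφ => apply_ofRealSchwartz_nonneg hu subset_rfl hsq hφ
    obtain ⟨χ, hχ⟩ := hone.1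
    have hmass : (μ.real univ : ℂ) = 1 := calc
      (μ.real univ : ℂ) = ∫ x, χ x ∂μ := by
        rw [integral_congr_ae (hμK.mono fun x hx =>
          (eventually_nhdsSet_iff_forall.1 hχ x hx).self_of_nhds), integral_const]
        simp
      _ = 1 := (hμ χ).symm.trans (hone.2 χ hχ)
    refine ⟨μ, ⟨?_⟩, hμ⟩
    rwa [Complex.ofReal_eq_one, measureReal_def, ENNReal.toReal_eq_one_iff] at hmass

theorem isPositiveDefiniteFunction_of_apply_normSqSchwartz_nonneg
    {C : EuclideanSpace ℝ (Fin n) → ℂ} (hexp : ∀ θ : EuclideanSpace ℝ (Fin n), HasIntegral u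
      (fun x => Complex.exp (Complex.I * (inner ℝ θ x : ℝ))) (C θ))
    (hsq : ∀ ψ, 0 ≤ u (normSqSchwartz ψ)) : IsPositiveDefiniteFunction C := by
  refine isPositiveDefiniteFunction_iff.2 fun m t c => ?_
  choose ψ hψ using fun j => (hexp (t j)).1
  let ψψ (j k : Fin m) : 𝓢(EuclideanSpace ℝ (Fin n), ℂ) :=
    SchwartzMap.smulLeftCLM ℂ (ψ j) (conjSchwartz (ψ k))
  have hψψ : ∀ j k x, ψψ j k x = ψ j x * conj (ψ k x) := fun j k =>
    SchwartzMap.smulLeftCLM_apply_apply (ψ j).hasTemperateGrowth _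
  have hC : ∀ j k, u (ψψ j k) = C (t j - t k) := fun j k =>
    (hexp (t j - t k)).2 _ (((hψ j).and (hψ k)).mono fun x hx => by
      rw [hψψ, hx.1, hx.2, conj_exp_I_mul_ofReal, ← Complex.exp_add, ← mul_add,
        ← Complex.ofReal_add, ← sub_eq_add_neg, ← inner_sub_left])
  have hexpand : normSqSchwartz (∑ j, c j • ψ j) =
      ∑ j, ∑ k, (c j * conj (c k)) • ψψ j k := by
    ext x
    simp only [normSqSchwartz_apply, sum_apply, smul_apply, smul_eq_mul, hψψ, map_sum, map_mul,
      Finset.sum_mul_sum, mul_mul_mul_comm]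
  have hnonneg := hsq (∑ j, c j • ψ j)
  simpa only [hexpand, map_sum, map_smul, hC, smul_eq_mul] using hnonneg

theorem integral_mem_closure_span {α F : Type*} [MeasurableSpace α] {μ : Measure α}
    [NormedAddCommGroup F] [NormedSpace ℝ F] [CompleteSpace F] {S : Set F} {f : α → F}
    (hf : Integrable f μ) (hS : ∀ x, f x ∈ S) :
    ∫ x, f x ∂μ ∈ closure (Submodule.span ℝ S : Set F) := by
  by_contra hnot
  obtain ⟨g, c, hgc, hc⟩ := geometric_hahn_banach_closed_point
    (Submodule.span ℝ S).convex.closure isClosed_closure hnot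
  have hc0 : 0 < c := by simpa using hgc 0 (subset_closure (zero_mem _))
  have hg0 : ∀ x, g (f x) = 0 := fun x => by
    by_contra hne
    have hlt := hgc ((c / g (f x)) • f x)
      (subset_closure (Submodule.smul_mem _ _ (Submodule.subset_span (hS x))))
    rw [map_smul, smul_eq_mul, div_mul_cancel₀ _ hne] at hlt
    exact hlt.false
  rw [← g.integral_comp_comm hf] at hc
  simp only [hg0, integral_zero] at hc
  exact hc.not_gt hc0

variable {𝔄 : Type*} [NormedCommRing 𝔄] [NormedAlgebra ℂ 𝔄] [CompleteSpace 𝔄]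
  {B : EuclideanSpace ℝ (Fin n) →L[ℝ] 𝔄} {l : 𝔄 →L[ℂ] ℂ}

theorem IsPositiveDefiniteFunction.apply_fst_mul_snd_nonneg
    (hl : IsPositiveDefiniteFunction fun θ => l (jointExp B θ)) {z : 𝔄 × 𝔄}
    (hz : z ∈ Submodule.span ℝ (range fun p : ℂ × EuclideanSpace ℝ (Fin n) =>
      (p.1 • jointExp B p.2, conj p.1 • jointExp B (-p.2)))) : 0 ≤ l (z.1 * z.2) := by
  obtain ⟨m, r, p, rfl⟩ := Submodule.mem_span_set'.1 hz
  choose q hq using fun i => (p i).2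
  refine (isPositiveDefiniteFunction_iff.1 hl m (fun j => (q j).2)
    fun j => r j * (q j).1).trans_eq ?_
  rw [Prod.fst_sum, Prod.snd_sum, Finset.sum_mul_sum, map_sum]
  refine Finset.sum_congr rfl fun j _ => ?_
  rw [map_sum]
  refine Finset.sum_congr rfl fun k _ => ?_
  rw [← hq j, ← hq k, sub_eq_add_neg, jointExp_add, map_mul, Complex.conj_ofReal]
  simp only [Prod.smul_mk]
  rw [smul_mul_smul_comm, smul_mul_smul_comm, ← Complex.coe_smul, map_smul, map_smul,
    smul_eq_mul, smul_eq_mul, Complex.ofReal_mul]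
  ring

theorem IsPositiveDefiniteFunction.apply_smear_mul_smear_nonneg
    (hl : IsPositiveDefiniteFunction fun θ => l (jointExp B θ)) (hB : GeneratesBoundedGroup B)
    {f g : 𝓢(EuclideanSpace ℝ (Fin n), ℂ)} (hg : ∀ θ, g (-θ) = conj (f θ)) :
    0 ≤ l (hB.smear f * hB.smear g) := by
  have hf_int := hB.integrable_smul f
  have hg_int : Integrable fun θ => conj (f θ) • jointExp B (-θ) := by
    simpa only [hg] using (hB.integrable_smul g).comp_neg
  have hpair : (hB.smear f, hB.smear g) =
      ∫ θ, (f θ • jointExp B θ, conj (f θ) • jointExp B (-θ)) := by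
    rw [integral_pair hf_int hg_int, hB.smear_apply, hB.smear_apply,
      ← integral_neg_eq_self (fun θ => g θ • jointExp B θ)]
    simp only [hg]
  have hmem : (hB.smear f, hB.smear g) ∈ closure (Submodule.span ℝ
      (range fun p : ℂ × EuclideanSpace ℝ (Fin n) =>
        (p.1 • jointExp B p.2, conj p.1 • jointExp B (-p.2))) : Set (𝔄 × 𝔄)) :=
    hpair ▸ integral_mem_closure_span (hf_int.prodMk hg_int) fun θ => ⟨(f θ, θ), rfl⟩
  have hclosed : IsClosed {z : 𝔄 × 𝔄 | 0 ≤ l (z.1 * z.2)} :=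
    isClosed_le continuous_const (l.continuous.comp (continuous_fst.mul continuous_snd))
  exact closure_minimal (fun z hz => hl.apply_fst_mul_snd_nonneg hz) hclosed hmem

theorem IsPositiveDefiniteFunction.distribution_normSqSchwartz_nonneg
    (hl : IsPositiveDefiniteFunction fun θ => l (jointExp B θ)) (hB : GeneratesBoundedGroup B)
    (φ : 𝓢(EuclideanSpace ℝ (Fin n), ℂ)) : 0 ≤ hB.distribution l (normSqSchwartz φ) := by
  obtain ⟨f, rfl⟩ := (charTransformCLE n).surjective φ
  rw [hB.distribution_apply, normSqSchwartz, hB.calculus_smulLeftCLM, charTransformCLE_apply,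
    conjSchwartz_charTransform, hB.calculus_charTransform, hB.calculus_charTransform]
  refine hl.apply_smear_mul_smear_nonneg hB fun θ => ?_
  change conj (f (- -θ)) = _
  rw [neg_neg]

end BochnerCondition

end

theorem theorem1 {H : Type*} [NormedAddCommGroup H] [InnerProductSpace ℂ H] [CompleteSpace H]
    (ρ : H →L[ℂ] H) (hρ : IsState ρ)
    (Ψ : HilbertTensorDual H) (hΨ : IsCanonicalPurification ρ Ψ)
    (n : ℕ) (A : Fin n → H →L[ℂ] H) (hA : ∀ j, IsSelfAdjoint (A j))
    (N : ℕ) (hN : 0 < N) (w : Equiv.Perm (Fin n) → ℂ) (hw : ∑ σ, w σ = 1) :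
    ContDiff ℝ ∞ (qcf A N w Ψ) ∧ (∃ M : ℝ, ∀ θ, ‖qcf A N w Ψ θ‖ ≤ M) ∧
    ∃ Pr : 𝓢'(EuclideanSpace ℝ (Fin n), ℂ),
      -- existence, in `ℰ'(ℝⁿ)`
      IsCompactlySupported Pr ∧ IsFourierTransform Pr (qcf A N w Ψ) ∧
      (∀ θ : EuclideanSpace ℝ (Fin n), HasIntegral Pr
        (fun x => Complex.exp (Complex.I * (inner ℝ θ x : ℝ))) (qcf A N w Ψ θ)) ∧
      -- uniqueness, for both readings of the Fourier transform
      (∀ u : 𝓢'(EuclideanSpace ℝ (Fin n), ℂ), IsFourierTransform u (qcf A N w Ψ) → u = Pr) ∧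
      (∀ u : 𝓢'(EuclideanSpace ℝ (Fin n), ℂ), IsCompactlySupported u →
        (∀ θ : EuclideanSpace ℝ (Fin n), HasIntegral u
          (fun x => Complex.exp (Complex.I * (inner ℝ θ x : ℝ))) (qcf A N w Ψ θ)) → u = Pr) ∧
      -- localization of the support
      Distribution.dsupport Pr ⊆ {x | ∀ j, x j ∈ averages N (spectrum ℝ (A j))} ∧
      -- normalization
      HasIntegral Pr (fun _ => 1) 1 ∧
      -- moments
      (∀ α : Fin n → ℕ, HasIntegral Pr (fun x => ((∏ j, x j ^ α j : ℝ) : ℂ))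
        ((1 / Complex.I ^ (∑ j, α j)) * mixedPartialDeriv α (qcf A N w Ψ) 0)) ∧
      -- reality
      (IsRealDistribution Pr ↔ ∀ θ, qcf A N w Ψ (-θ) = conj (qcf A N w Ψ θ)) ∧
      (FiniteDimensional ℂ H →
        (IsSignedMeasureDistribution Pr ↔ ∀ θ, qcf A N w Ψ (-θ) = conj (qcf A N w Ψ θ))) ∧
      -- nonnegativity
      (IsProbabilityDistribution Pr ↔ IsPositiveDefiniteFunction (qcf A N w Ψ)) := by
  obtain ⟨𝔄, _, _, _, B, l, hB, hBK, hC⟩ := exists_jointExp_eq_qcf hA N w Ψ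
  have hK := isCompact_pi_averages_spectrum A N
  have hcomp := hB.isCompactlySupported_distribution hBK hK l
  have hF : IsFourierTransform (hB.distribution l) (qcf A N w Ψ) :=
    hC ▸ hB.isFourierTransform_distribution l
  have hexp : ∀ θ : EuclideanSpace ℝ (Fin n), HasIntegral (hB.distribution l)
      (fun x => Complex.exp (Complex.I * (inner ℝ θ x : ℝ))) (qcf A N w Ψ θ) := fun θ =>
    congrFun hC θ ▸ (hB.hasValue_exp hBK hK θ).hasIntegral hBK hK l
  have hone : HasIntegral (hB.distribution l) (fun _ => 1) 1 := by
    have h0 : l 1 = 1 := by rw [← jointExp_zero B, ← qcf_zero hρ hΨ A N hw, hC]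
    exact (congrArg (HasIntegral _ _) h0).mp ((hB.hasValue_one hBK hK).hasIntegral hBK hK l)
  have hreal := isRealDistribution_iff hF hexp
  refine ⟨hC ▸ (l.restrictScalars ℝ).contDiff.comp (contDiff_jointExp B),
    hC ▸ hB.exists_norm_apply_jointExp_le l, hB.distribution l, hcomp, hF, hexp,
    fun u hu => hu.unique hF, fun u hu hu' => eq_of_hasIntegral_exp hu hcomp hu' hexp,
    hB.dsupport_distribution_subset hBK hK l, hone,
    fun α => hC ▸ hB.hasIntegral_monomial_distribution hBK hK l α, hreal, fun _ => ?_,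
    (isProbabilityDistribution_iff hcomp hone).trans
      ⟨isPositiveDefiniteFunction_of_apply_normSqSchwartz_nonneg hexp, fun h =>
        (hC ▸ h : IsPositiveDefiniteFunction _).distribution_normSqSchwartz_nonneg hB⟩⟩
  obtain ⟨S, _, c, x, hS⟩ := exists_qcf_eq_sum hA N w Ψ
  exact (isRealDistribution_iff_isSignedMeasureDistribution hF hS).symm.trans hreal
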